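/- Let $W\in\mathbb{R}^{\ell\times n}$ have rows $w_1,\dots,w_\ell$. For nonzero $x,y\in\mathbb{R}^n$ put $\hat x=x/\|x\|_2$, $\hat y=y/\|y\|_2$, let $\theta\in[0,\pi]$ be the angle between $x$ and $y$, let $M_{\hat x\leftrightarrow\hat y}\in\mathbb{R}^{n\times n}$ be the matrix with $M\hat x=\hat y$, $M\hat y=\hat x$ and $Mz=0$ for all $z\in\mathrm{span}(x,y)^\perp$, and let $$Q_{x,y}=\frac{\pi-\theta}{2\pi}I_n+\frac{\sin\theta}{2\pi}M_{\hat x\leftrightarrow\hat y}.$$ We say that $W$ satisfies the Weight Distribution Condition (WDC) with constants $\epsilon>0$ and $0<\alpha\le 1$ if for all nonzero $x,y\in\mathbb{R}^n$, in the spectral norm, $$\Big\|\sum_{i=1}^{\ell}\mathbf 1_{w_i\cdot x>0}\,\mathbf 1_{w_i\cdot y>0}\;w_iw_i^{\top}-\alpha\,Q_{x,y}\Big\|\le\epsilon .$$ **Lemma.** There are absolute constants $C>0$ and $k\in\mathbb{N}$, $k\ge 1$, such that for every $0<\epsilon<1$ there are $c,\gamma>0$, depending only on $\epsilon$, with $c\le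 C\epsilon^{-k}$ and $\gamma^{-1}\le C\epsilon^{-k}$, for which the following holds. Let $n\ge 1$ and $\ell\ge 0$ be integers with $\ell>c\,n\log n$. Let $g_1,\dots,g_\ell$ be independent random vectors with law $\mathcal N(0,\tfrac1\ell I_n)$, and let $W\in\mathbb{R}^{\ell\times n}$ be the random matrix whose $i$th row is $w_i=g_i\cdot\mathbf 1_{\|g_i\|_2\le 3\sqrt{n/\ell}}$ (that is, $g_i$ if $\|g_i\|_2\le 3\sqrt{n/\ell}$, and $0$ otherwise). Then, on an event of probability at least $1-8n\,e^{-\gamma n}$, $W$ satisfies the WDC with constants $\epsilon$ and $$\alpha=\frac{\Gamma\left(\frac{n+2}{2}\right)-\Gamma\left(\frac{n+2}{2},\frac{9n}{2}\right)}{\Gamma\left(\frac{n+2}{2}\right)},$$ where $\Gamma(s)$ is the Gamma function and $\Gamma(s,a)=\int_a^\infty t^{s-1}e^{-t}\,dt$ is the upper incomplete Gamma function. -/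

import Mathlib

open MeasureTheory ProbabilityTheory

noncomputable section

/-- The unit vector in the direction of a nonzero vector `x`. -/
def unitVec {n : ℕ} (x : EuclideanSpace ℝ (Fin n)) : EuclideanSpace ℝ (Fin n) :=
  ‖x‖⁻¹ • x

/-- The matrix `v vᵀ / ‖v‖²` of the orthogonal projection onto the line spanned by `v`
(the zero matrix if `v = 0`). -/
def lineProj {n : ℕ} (v : EuclideanSpace ℝ (Fin n)) : Matrix (Fin n) (Fin n) ℝ :=
  (‖v‖ ^ 2)⁻¹ • Matrix.vecMulVec v.ofLp v.ofLp

/-- For nonzero `x`, `y` with directions `x̂`, `ŷ`: the matrix that sends `x̂` to `ŷ`, `ŷ` to `x̂`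
and every vector orthogonal to `x` and `y` to `0`. It is the projection onto the line of
`x̂ + ŷ` minus the projection onto the line of `x̂ - ŷ`; the defining properties are proved in
`swapMatrix_mulVec_left`, `swapMatrix_mulVec_right`, `swapMatrix_mulVec_orthogonal`. -/
def swapMatrix {n : ℕ} (x y : EuclideanSpace ℝ (Fin n)) : Matrix (Fin n) (Fin n) ℝ :=
  lineProj (unitVec x + unitVec y) - lineProj (unitVec x - unitVec y)

/-- `Q_{x,y} = (π - θ)/(2π) I + (sin θ)/(2π) M_{x̂ ↔ ŷ}`, where `θ` is the angle of `x` and `y`. -/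
def QMatrix {n : ℕ} (x y : EuclideanSpace ℝ (Fin n)) : Matrix (Fin n) (Fin n) ℝ :=
  ((Real.pi - InnerProductGeometry.angle x y) / (2 * Real.pi)) • (1 : Matrix (Fin n) (Fin n) ℝ)
    + (Real.sin (InnerProductGeometry.angle x y) / (2 * Real.pi)) • swapMatrix x y

/-- `∑ i, 1_{wᵢ · x > 0} 1_{wᵢ · y > 0} wᵢ wᵢᵀ`, where `wᵢ` is the `i`th row of `W`. -/
def activeGram {ℓ n : ℕ} (W : Matrix (Fin ℓ) (Fin n) ℝ) (x y : EuclideanSpace ℝ (Fin n)) :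
    Matrix (Fin n) (Fin n) ℝ :=
  ∑ i : Fin ℓ,
    (if 0 < W i ⬝ᵥ x.ofLp then (1 : ℝ) else 0) •
      (if 0 < W i ⬝ᵥ y.ofLp then (1 : ℝ) else 0) • Matrix.vecMulVec (W i) (W i)

/-- The Weight Distribution Condition with constants `ε > 0` and `0 < α ≤ 1`. The norm is the
spectral norm, that is, the operator norm for the Euclidean norms. -/
def WDC {ℓ n : ℕ} (W : Matrix (Fin ℓ) (Fin n) ℝ) (ε α : ℝ) : Prop :=
  0 < ε ∧ 0 < α ∧ α ≤ 1 ∧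
    ∀ x y : EuclideanSpace ℝ (Fin n), x ≠ 0 → y ≠ 0 →
      ‖Matrix.toEuclideanCLM (n := Fin n) (𝕜 := ℝ) (activeGram W x y - α • QMatrix x y)‖ ≤ ε

/-- The upper incomplete Gamma function `Γ(s, a) = ∫_a^∞ t^(s-1) e^(-t) dt`. -/
def upperGamma (s a : ℝ) : ℝ :=
  ∫ t in Set.Ioi a, t ^ (s - 1) * Real.exp (-t)

/-- `α = (Γ((n+2)/2) - Γ((n+2)/2, 9n/2)) / Γ((n+2)/2)`. -/
def truncAlpha (n : ℕ) : ℝ :=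
  (Real.Gamma (((n : ℝ) + 2) / 2) - upperGamma (((n : ℝ) + 2) / 2) (9 * (n : ℝ) / 2)) /
    Real.Gamma (((n : ℝ) + 2) / 2)

/-- The truncation `w · 1_{‖w‖ ≤ R}`: the vector `w` if `‖w‖ ≤ R`, and `0` otherwise. -/
def truncVec {n : ℕ} (R : ℝ) (w : EuclideanSpace ℝ (Fin n)) : EuclideanSpace ℝ (Fin n) :=
  Set.indicator {v | ‖v‖ ≤ R} (fun v => v) w

/-- The `ℓ × n` matrix whose `i`th row is `wᵢ · 1_{‖wᵢ‖ ≤ 3 √(n/ℓ)}`. -/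
def truncMatrix {ℓ n : ℕ} (w : Fin ℓ → EuclideanSpace ℝ (Fin n)) : Matrix (Fin ℓ) (Fin n) ℝ :=
  Matrix.of fun i => (truncVec (3 * Real.sqrt ((n : ℝ) / (ℓ : ℝ))) (w i)).ofLp

theorem lineProj_mulVec {n : ℕ} (v z : EuclideanSpace ℝ (Fin n)) :
    (lineProj v).mulVec z.ofLp = ((‖v‖ ^ 2)⁻¹ * inner ℝ v z) • v.ofLp := by
  have h : inner ℝ v z = v.ofLp ⬝ᵥ z.ofLp := by
    simp [PiLp.inner_apply, dotProduct, mul_comm]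
  ext i
  simp only [lineProj, Matrix.smul_mulVec, Matrix.vecMulVec_mulVec, h, Pi.smul_apply, smul_eq_mul,
    MulOpposite.smul_eq_mul_unop, MulOpposite.unop_op]
  ring

theorem lineProj_mulVec_self {n : ℕ} (v : EuclideanSpace ℝ (Fin n)) :
    (lineProj v).mulVec v.ofLp = v.ofLp := by
  rw [lineProj_mulVec, real_inner_self_eq_norm_sq]
  by_cases hv : v = 0
  · simp [hv]
  · rw [inv_mul_cancel₀ (by simpa using hv), one_smul]

theorem lineProj_mulVec_of_inner_eq_zero {n : ℕ} {v z : EuclideanSpace ℝ (Fin n)}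
    (h : inner ℝ v z = 0) : (lineProj v).mulVec z.ofLp = 0 := by
  rw [lineProj_mulVec, h, mul_zero, zero_smul]

theorem norm_unitVec {n : ℕ} {x : EuclideanSpace ℝ (Fin n)} (hx : x ≠ 0) : ‖unitVec x‖ = 1 := by
  simp [unitVec, norm_smul, hx]

theorem swapMatrix_comm {n : ℕ} (x y : EuclideanSpace ℝ (Fin n)) :
    swapMatrix x y = swapMatrix y x := by
  have h : unitVec y - unitVec x = -(unitVec x - unitVec y) := by abel
  have h2 : ∀ v : EuclideanSpace ℝ (Fin n), lineProj (-v) = lineProj v := by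
    intro v
    simp [lineProj, Matrix.neg_vecMulVec, Matrix.vecMulVec_neg]
  rw [swapMatrix, swapMatrix, h, h2, add_comm (unitVec y)]

theorem swapMatrix_mulVec_left {n : ℕ} {x y : EuclideanSpace ℝ (Fin n)} (hx : x ≠ 0)
    (hy : y ≠ 0) : (swapMatrix x y).mulVec (unitVec x).ofLp = (unitVec y).ofLp := by
  set a := unitVec x with ha
  set b := unitVec y with hb
  have hab : inner ℝ (a + b) (a - b) = 0 := by
    rw [real_inner_add_sub_eq_zero_iff, ha, hb, norm_unitVec hx, norm_unitVec hy]
  have hba : inner ℝ (a - b) (a + b) = 0 := by rw [real_inner_comm]; exact hab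
  have hsplit : a.ofLp = (1 / 2 : ℝ) • ((a + b).ofLp + (a - b).ofLp) := by
    ext i; simp; ring
  rw [hsplit, Matrix.mulVec_smul, Matrix.mulVec_add, swapMatrix, ← ha, ← hb,
    Matrix.sub_mulVec, Matrix.sub_mulVec, lineProj_mulVec_self, lineProj_mulVec_self,
    lineProj_mulVec_of_inner_eq_zero hab, lineProj_mulVec_of_inner_eq_zero hba]
  ext i; simp; ring

theorem swapMatrix_mulVec_right {n : ℕ} {x y : EuclideanSpace ℝ (Fin n)} (hx : x ≠ 0)
    (hy : y ≠ 0) : (swapMatrix x y).mulVec (unitVec y).ofLp = (unitVec x).ofLp := by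
  rw [swapMatrix_comm]
  exact swapMatrix_mulVec_left hy hx

theorem swapMatrix_mulVec_orthogonal {n : ℕ} {x y z : EuclideanSpace ℝ (Fin n)}
    (hx : inner ℝ x z = 0) (hy : inner ℝ y z = 0) : (swapMatrix x y).mulVec z.ofLp = 0 := by
  have h1 : inner ℝ (unitVec x) z = 0 := by simp [unitVec, inner_smul_left, hx]
  have h2 : inner ℝ (unitVec y) z = 0 := by simp [unitVec, inner_smul_left, hy]
  rw [swapMatrix, Matrix.sub_mulVec,
    lineProj_mulVec_of_inner_eq_zero (by rw [inner_add_left, h1, h2, add_zero]),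
    lineProj_mulVec_of_inner_eq_zero (by rw [inner_sub_left, h1, h2, sub_zero]), sub_zero]

end

/-!
By homogeneity the condition is a bound, uniform over unit vectors `x`, `y`, `u`, for the deviation
from its mean of the empirical quadratic form of the truncated standard Gaussian vectors
`z = √ℓ g`: the function `⟪u, z⟫²` restricted to `0 < ⟪x, z⟫`, `0 < ⟪y, z⟫` and `‖z‖ ≤ 3 √n`.
The form is homogeneous of degree two, so the truncation acts on the radial part only and multiplies
the expectation by `α`; without truncation the expectation is a planar integral over a sector, which
gives `Q`.

The form is discontinuous in `x` and `y`, but it is monotone in the thresholds of the half-spaces.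
For `x` within `δ` of a net point `x'` and `‖z‖ ≤ R`, the half-space of `x` lies between
`⟪x', z⟫ > R δ` and `⟪x', z⟫ > - R δ`. Bernstein's inequality therefore only has to be applied at
net points with these two thresholds, and the two expectations differ by the small contribution of a
slab of width `2 R δ`.
-/

section StandardGaussian

variable {E : Type*} [NormedAddCommGroup E] [InnerProductSpace ℝ E] [FiniteDimensional ℝ E]
  [MeasurableSpace E] [BorelSpace E]

theorem integrable_exp_neg_norm_sq_div_two :
    Integrable fun x : E => Real.exp (-‖x‖ ^ 2 / 2) := by
  have h := GaussianFourier.integral_rexp_neg_mul_sq_norm (V := E) (b := 1 / 2) (by norm_num)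
  refine (Integrable.of_integral_ne_zero (h.trans_ne (by positivity))).congr
    (.of_forall fun x => ?_)
  ring_nf

theorem stdGaussian_eq_withDensity_volume :
    stdGaussian E = volume.withDensity fun x => ENNReal.ofReal
      ((2 * Real.pi) ^ (-(Module.finrank ℝ E : ℝ) / 2) * Real.exp (-‖x‖ ^ 2 / 2)) := by
  have := isFiniteMeasure_withDensity_ofReal
    ((integrable_exp_neg_norm_sq_div_two (E := E)).const_mul
      ((2 * Real.pi) ^ (-(Module.finrank ℝ E : ℝ) / 2))).2
  refine Measure.ext_of_charFun (funext fun t => ?_)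
  have hFourier := GaussianFourier.integral_cexp_neg_mul_sq_norm_add
    (V := E) (b := 1 / 2) (by norm_num) Complex.I t
  have hpow : ((Real.pi : ℂ) / (1 / 2)) ^ ((Module.finrank ℝ E : ℂ) / 2) =
      (((2 * Real.pi) ^ ((Module.finrank ℝ E : ℝ) / 2) : ℝ) : ℂ) := by
    rw [Complex.ofReal_cpow (by positivity)]
    push_cast
    ring_nf
  have hintegrand (v : E) : (ENNReal.ofReal ((2 * Real.pi) ^ (-(Module.finrank ℝ E : ℝ) / 2) *
      Real.exp (-‖v‖ ^ 2 / 2))).toReal • Complex.exp (inner ℝ v t * Complex.I) =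
      ((2 * Real.pi) ^ (-(Module.finrank ℝ E : ℝ) / 2) : ℝ) *
        Complex.exp (-(1 / 2) * ‖v‖ ^ 2 + Complex.I * inner ℝ t v) := by
    rw [ENNReal.toReal_ofReal (by positivity), Complex.real_smul, Complex.exp_add, real_inner_comm]
    push_cast
    rw [mul_assoc]
    congr 3 <;> ring_nf
  rw [charFun_stdGaussian, charFun_apply, integral_withDensity_eq_integral_toReal_smul
    (by fun_prop) (by simp)]
  simp_rw [hintegrand]
  rw [integral_const_mul, hFourier, hpow, ← mul_assoc, ← Complex.ofReal_mul,
    ← Real.rpow_add (by positivity), neg_div, neg_div, neg_add_cancel, Real.rpow_zero,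
    Complex.ofReal_one, one_mul, Complex.I_sq]
  ring_nf

theorem integral_stdGaussian_eq_integral_volume (f : E → ℝ) :
    ∫ x, f x ∂stdGaussian E = (2 * Real.pi) ^ (-(Module.finrank ℝ E : ℝ) / 2) *
      ∫ x, f x * Real.exp (-‖x‖ ^ 2 / 2) := by
  rw [stdGaussian_eq_withDensity_volume, integral_withDensity_eq_integral_toReal_smul
    (by fun_prop) (by simp), ← integral_const_mul]
  refine integral_congr_ae (.of_forall fun x => ?_)
  simp only [smul_eq_mul, ENNReal.toReal_ofReal (by positivity :
    0 ≤ (2 * Real.pi) ^ (-(Module.finrank ℝ E : ℝ) / 2) * Real.exp (-‖x‖ ^ 2 / 2))]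
  ring

theorem covariance_inner_stdGaussian (u v : E) :
    cov[fun g => inner ℝ u g, fun g => inner ℝ v g; stdGaussian E] = inner ℝ u v := by
  rw [← covarianceBilin_apply_eq_cov IsGaussian.memLp_two_id, covarianceBilin_stdGaussian,
    innerSL_apply_apply]

theorem hasLaw_inner_stdGaussian (v : E) :
    HasLaw (fun g => inner ℝ v g) (gaussianReal 0 (‖v‖₊ ^ 2)) (stdGaussian E) where
  aemeasurable := by fun_prop
  map_eq := by
    have hgauss : HasGaussianLaw (fun g : E => inner ℝ v g) (stdGaussian E) :=
      IsGaussian.hasGaussianLaw_id.map_fun (innerSL ℝ v)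
    have hmean : ∫ g : E, inner ℝ v g ∂stdGaussian E = 0 :=
      integral_strongDual_stdGaussian (innerSL ℝ v)
    rw [hgauss.map_eq_gaussianReal, hmean, ← covariance_self hgauss.aemeasurable,
      covariance_inner_stdGaussian, real_inner_self_eq_norm_sq, ← coe_nnnorm, ← NNReal.coe_pow,
      Real.toNNReal_coe]

theorem hasLaw_inner_stdGaussian_of_norm_eq_one {v : E} (hv : ‖v‖ = 1) :
    HasLaw (fun g => inner ℝ v g) (gaussianReal 0 1) (stdGaussian E) := by
  have hv' : ‖v‖₊ = 1 := NNReal.eq hv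
  simpa only [hv', one_pow] using hasLaw_inner_stdGaussian v

theorem iIndepFun_inner_stdGaussian {ι : Type*} [Finite ι] {v : ι → E}
    (hv : Pairwise fun i j => inner ℝ (v i) (v j) = 0) :
    iIndepFun (fun i g => inner ℝ (v i) g) (stdGaussian E) := by
  have := Fintype.ofFinite ι
  refine HasGaussianLaw.iIndepFun_of_covariance_eq_zero
    (IsGaussian.hasGaussianLaw_id.map_fun (ContinuousLinearMap.pi fun i => innerSL ℝ (v i)))
    fun i j hij => ?_
  rw [covariance_inner_stdGaussian, hv hij]

end StandardGaussian

section PolarCoordinates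

theorem integral_homogeneous_mul_comp_norm {E : Type*} [NormedAddCommGroup E] [NormedSpace ℝ E]
    [FiniteDimensional ℝ E] [Nontrivial E] [MeasurableSpace E] [BorelSpace E] (μ : Measure E)
    [μ.IsAddHaarMeasure] {k : ℕ} {f : E → ℝ}
    (hf : ∀ (r : ℝ) x, 0 < r → f (r • x) = r ^ k * f x) (h : ℝ → ℝ) :
    ∫ x, f x * h ‖x‖ ∂μ = (∫ x : Metric.sphere (0 : E) 1, f x ∂μ.toSphere) *
      ∫ r in Set.Ioi (0 : ℝ), r ^ ((Module.finrank ℝ E + k : ℝ) - 1) * h r := by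
  calc ∫ x, f x * h ‖x‖ ∂μ
      = ∫ x : ({0}ᶜ : Set E), f x * h ‖x.1‖ ∂(μ.comap Subtype.val) := by
        rw [integral_subtype_comap (measurableSet_singleton _).compl fun x => f x * h ‖x‖,
          restrict_compl_singleton]
    _ = ∫ x : Metric.sphere (0 : E) 1 × Set.Ioi (0 : ℝ), f x.1.1 * (x.2.1 ^ k * h x.2.1)
          ∂(μ.toSphere.prod (.volumeIoiPow (Module.finrank ℝ E - 1))) := by
        rw [← μ.measurePreserving_homeomorphUnitSphereProd.integral_comp
          (Homeomorph.measurableEmbedding _) fun x => f x.1.1 * (x.2.1 ^ k * h x.2.1)]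
        refine integral_congr_ae (.of_forall fun x => ?_)
        have hx : 0 < ‖x.1‖ := norm_pos_iff.2 x.2
        simp only [homeomorphUnitSphereProd_apply_snd_coe, homeomorphUnitSphereProd_apply_fst_coe]
        rw [hf _ _ (inv_pos.2 hx), inv_pow]
        field_simp
    _ = _ := by
        rw [integral_prod_mul (fun x : Metric.sphere (0 : E) 1 => f x)
          (fun r : Set.Ioi (0 : ℝ) => r.1 ^ k * h r.1)]
        congr 1
        simp only [Measure.volumeIoiPow, ENNReal.ofReal]
        rw [integral_withDensity_eq_integral_smul (by fun_prop),
          integral_subtype_comap measurableSet_Ioi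
            fun r => Real.toNNReal (r ^ (Module.finrank ℝ E - 1)) • (r ^ k * h r)]
        refine setIntegral_congr_fun measurableSet_Ioi fun r (hr : 0 < r) => ?_
        have hexponent : ((Module.finrank ℝ E + k : ℝ) - 1) =
            ((Module.finrank ℝ E - 1 + k : ℕ) : ℝ) := by
          push_cast [Nat.cast_sub (Module.finrank_pos (R := ℝ) (M := E))]
          ring
        simp only [NNReal.smul_def, Real.coe_toNNReal _ (pow_nonneg hr.le _), smul_eq_mul,
          hexponent, Real.rpow_natCast, pow_add, mul_assoc]

theorem integral_rpow_mul_comp_sq_div_two (s : ℝ) (φ : ℝ → ℝ) :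
    ∫ r in Set.Ioi (0 : ℝ), r ^ (2 * s - 1) * φ (r ^ 2 / 2) =
      2 ^ (s - 1) * ∫ t in Set.Ioi (0 : ℝ), t ^ (s - 1) * φ t := by
  have hsq := integral_comp_rpow_Ioi_of_pos (E := ℝ)
    (g := fun t => (t / 2) ^ (s - 1) * φ (t / 2)) (p := 2) two_pos
  have hhalf := integral_comp_mul_left_Ioi (fun t => t ^ (s - 1) * φ t) 0 (b := 1 / 2) (by norm_num)
  simp only [mul_zero, one_div, inv_inv, smul_eq_mul, inv_mul_eq_div] at hsq hhalf
  rw [hhalf] at hsq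
  rw [← mul_right_inj' (two_ne_zero (α := ℝ)), mul_left_comm, ← hsq, ← integral_const_mul,
    ← integral_const_mul]
  refine setIntegral_congr_fun measurableSet_Ioi fun r (hr : 0 < r) => ?_
  have hpow : r ^ (2 * s - 1) = 2 ^ (s - 1) * (r ^ 2 / 2) ^ (s - 1) * r := by
    rw [← Real.mul_rpow zero_le_two (by positivity), mul_div_cancel₀ _ two_ne_zero,
      ← Real.rpow_natCast r 2, ← Real.rpow_mul hr.le, ← Real.rpow_add_one hr.ne']
    congr 1
    push_cast
    ring
  simp only [Real.rpow_two, show (2 : ℝ) - 1 = 1 by norm_num, Real.rpow_one, hpow]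
  ring

variable {E : Type*} [NormedAddCommGroup E] [InnerProductSpace ℝ E] [FiniteDimensional ℝ E]
  [Nontrivial E] [MeasurableSpace E] [BorelSpace E]

theorem exists_integral_stdGaussian_homogeneous_mul_comp_norm_sq {k : ℕ} {f : E → ℝ}
    (hf : ∀ (r : ℝ) x, 0 < r → f (r • x) = r ^ k * f x) :
    ∃ A : ℝ, ∀ φ : ℝ → ℝ, ∫ g, f g * φ (‖g‖ ^ 2 / 2) ∂stdGaussian E =
      A * ∫ t in Set.Ioi (0 : ℝ),
        t ^ ((Module.finrank ℝ E + k : ℝ) / 2 - 1) * Real.exp (-t) * φ t := by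
  refine ⟨(2 * Real.pi) ^ (-(Module.finrank ℝ E : ℝ) / 2) *
    (∫ x : Metric.sphere (0 : E) 1, f x ∂volume.toSphere) *
    2 ^ ((Module.finrank ℝ E + k : ℝ) / 2 - 1), fun φ => ?_⟩
  have hpolar := integral_homogeneous_mul_comp_norm volume hf
    fun r => Real.exp (-(r ^ 2 / 2)) * φ (r ^ 2 / 2)
  have hradial := integral_rpow_mul_comp_sq_div_two ((Module.finrank ℝ E + k : ℝ) / 2)
    fun t => Real.exp (-t) * φ t
  rw [mul_div_cancel₀ _ (two_ne_zero' ℝ)] at hradial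
  rw [hradial] at hpolar
  simp only [integral_stdGaussian_eq_integral_volume, neg_div, mul_assoc, ← hpolar, mul_comm (φ _)]

theorem integrableOn_rpow_sub_one_mul_exp_neg {s : ℝ} (hs : 0 < s) :
    IntegrableOn (fun t : ℝ => t ^ (s - 1) * Real.exp (-t)) (Set.Ioi 0) :=
  (Real.GammaIntegral_convergent hs).congr (.of_forall fun _ => mul_comm _ _)

theorem upperGamma_zero {s : ℝ} (hs : 0 < s) : upperGamma s 0 = Real.Gamma s := by
  simp only [upperGamma, Real.Gamma_eq_integral hs, mul_comm]

theorem Gamma_sub_upperGamma {s a : ℝ} (hs : 0 < s) (ha : 0 ≤ a) :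
    Real.Gamma s - upperGamma s a = ∫ t in Set.Ioc 0 a, t ^ (s - 1) * Real.exp (-t) := by
  have hint := integrableOn_rpow_sub_one_mul_exp_neg hs
  rw [← upperGamma_zero hs, upperGamma, upperGamma, ← Set.Ioc_union_Ioi_eq_Ioi ha,
    setIntegral_union Set.Ioc_disjoint_Ioi_same measurableSet_Ioi
      (hint.mono_set Set.Ioc_subset_Ioi_self) (hint.mono_set (Set.Ioi_subset_Ioi ha)),
    add_sub_cancel_right]

theorem upperGamma_nonneg (s : ℝ) {a : ℝ} (ha : 0 ≤ a) : 0 ≤ upperGamma s a := by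
  refine setIntegral_nonneg measurableSet_Ioi fun t ht => ?_
  have : 0 < t := ha.trans_lt ht
  positivity

theorem upperGamma_lt_Gamma {s a : ℝ} (hs : 0 < s) (ha : 0 < a) :
    upperGamma s a < Real.Gamma s := by
  rw [← sub_pos, Gamma_sub_upperGamma hs ha.le, ← intervalIntegral.integral_of_le ha.le]
  refine intervalIntegral.intervalIntegral_pos_of_pos_on ?_ (fun t ht => ?_) ha
  · rw [intervalIntegrable_iff_integrableOn_Ioc_of_le ha.le]
    exact (integrableOn_rpow_sub_one_mul_exp_neg hs).mono_set Set.Ioc_subset_Ioi_self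
  · have := ht.1
    positivity

theorem truncAlpha_pos {n : ℕ} (hn : n ≠ 0) : 0 < truncAlpha n :=
  div_pos (sub_pos.2 (upperGamma_lt_Gamma (by positivity) (by positivity)))
    (Real.Gamma_pos_of_pos (by positivity))

theorem truncAlpha_le_one (n : ℕ) : truncAlpha n ≤ 1 :=
  div_le_one_of_le₀ (sub_le_self _ (upperGamma_nonneg _ (by positivity)))
    (Real.Gamma_pos_of_pos (by positivity)).le

theorem setIntegral_norm_le_stdGaussian_homogeneous {k : ℕ} {f : E → ℝ}
    (hf : ∀ (r : ℝ) x, 0 < r → f (r • x) = r ^ k * f x) {R : ℝ} (hR : 0 ≤ R) :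
    ∫ g in {g | ‖g‖ ≤ R}, f g ∂stdGaussian E =
      (Real.Gamma ((Module.finrank ℝ E + k) / 2) -
          upperGamma ((Module.finrank ℝ E + k) / 2) (R ^ 2 / 2)) /
        Real.Gamma ((Module.finrank ℝ E + k) / 2) * ∫ g, f g ∂stdGaussian E := by
  obtain ⟨A, hA⟩ := exists_integral_stdGaussian_homogeneous_mul_comp_norm_sq hf
  have hs : (0 : ℝ) < (Module.finrank ℝ E + k) / 2 := by
    have : 0 < Module.finrank ℝ E := Module.finrank_pos
    positivity
  have hball (g : E) : {g : E | ‖g‖ ≤ R}.indicator f g =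
      f g * (Set.Iic (R ^ 2 / 2)).indicator 1 (‖g‖ ^ 2 / 2) := by
    have hiff : ‖g‖ ^ 2 / 2 ∈ Set.Iic (R ^ 2 / 2) ↔ ‖g‖ ≤ R := by
      rw [Set.mem_Iic, div_le_div_iff_of_pos_right two_pos, sq_le_sq₀ (norm_nonneg g) hR]
    simp only [Set.indicator_apply, hiff, Set.mem_ofPred_eq, Pi.one_apply, mul_ite, mul_one,
      mul_zero]
  have htrunc := hA ((Set.Iic (R ^ 2 / 2)).indicator 1)
  have hcut (w : ℝ → ℝ) : ∫ t in Set.Ioi 0, w t * (Set.Iic (R ^ 2 / 2)).indicator 1 t =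
      ∫ t in Set.Ioc 0 (R ^ 2 / 2), w t := by
    rw [← Set.Ioi_inter_Iic, ← setIntegral_indicator measurableSet_Iic]
    simp only [Set.indicator_apply, Pi.one_apply, mul_ite, mul_one, mul_zero]
  simp only [← hball] at htrunc
  rw [integral_indicator (measurableSet_le (by fun_prop) (by fun_prop)), hcut,
    ← Gamma_sub_upperGamma hs (by positivity)] at htrunc
  have hfull := hA fun _ => 1
  simp only [mul_one] at hfull
  rw [← upperGamma, upperGamma_zero hs] at hfull
  have := Real.Gamma_pos_of_pos hs
  rw [htrunc, hfull]
  field_simp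

end PolarCoordinates

section PlanarSectors

theorem integral_gaussianReal_prod_eq_integral_volume (F : ℝ × ℝ → ℝ) :
    ∫ p, F p ∂(gaussianReal 0 1).prod (gaussianReal 0 1) =
      (2 * Real.pi)⁻¹ * ∫ p, F p * Real.exp (-(p.1 ^ 2 + p.2 ^ 2) / 2) := by
  have hdensity (p : ℝ × ℝ) : (gaussianPDF 0 1 p.1 * gaussianPDF 0 1 p.2).toReal =
      (2 * Real.pi)⁻¹ * Real.exp (-(p.1 ^ 2 + p.2 ^ 2) / 2) := by
    rw [ENNReal.toReal_mul, toReal_gaussianPDF, toReal_gaussianPDF, gaussianPDFReal_def]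
    simp only [NNReal.coe_one, mul_one, sub_zero]
    rw [mul_mul_mul_comm, ← mul_inv, Real.mul_self_sqrt (by positivity), ← Real.exp_add]
    ring_nf
  have hfinite (p : ℝ × ℝ) : gaussianPDF 0 1 p.1 * gaussianPDF 0 1 p.2 < ⊤ :=
    ENNReal.mul_lt_top ENNReal.ofReal_lt_top ENNReal.ofReal_lt_top
  rw [gaussianReal_of_var_ne_zero _ one_ne_zero, prod_withDensity (measurable_gaussianPDF _ _)
    (measurable_gaussianPDF _ _), ← Measure.volume_eq_prod,
    integral_withDensity_eq_integral_toReal_smul (by fun_prop)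
    (.of_forall hfinite), ← integral_const_mul]
  simp only [hdensity, smul_eq_mul, mul_assoc, mul_comm (Real.exp _)]

theorem integral_pow_add_one_mul_exp_neg_sq_div_two (k : ℕ) :
    ∫ r in Set.Ioi (0 : ℝ), r ^ (k + 1) * Real.exp (-r ^ 2 / 2) =
      2 ^ ((k : ℝ) / 2) * Real.Gamma ((k : ℝ) / 2 + 1) := by
  have h := integral_rpow_mul_comp_sq_div_two ((k : ℝ) / 2 + 1) fun t => Real.exp (-t)
  rw [show 2 * ((k : ℝ) / 2 + 1) - 1 = ((k + 1 : ℕ) : ℝ) by push_cast; ring, ← upperGamma,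
    upperGamma_zero (by positivity), add_sub_cancel_right] at h
  simpa only [Real.rpow_natCast, neg_div] using h

theorem integral_gaussianReal_prod_homogeneous {k : ℕ} {F : ℝ × ℝ → ℝ}
    (hF : ∀ (r : ℝ) p, 0 < r → F (r • p) = r ^ k * F p) :
    ∫ p, F p ∂(gaussianReal 0 1).prod (gaussianReal 0 1) =
      2 ^ ((k : ℝ) / 2) * Real.Gamma ((k : ℝ) / 2 + 1) / (2 * Real.pi) *
        ∫ φ in Set.Ioo (-Real.pi) Real.pi, F (Real.cos φ, Real.sin φ) := by
  rw [integral_gaussianReal_prod_eq_integral_volume, ← integral_comp_polarCoord_symm,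
    polarCoord_target, ← integral_pow_add_one_mul_exp_neg_sq_div_two, div_eq_inv_mul, mul_assoc,
    ← integral_prod_mul, Measure.prod_restrict, ← Measure.volume_eq_prod]
  congr 1
  refine setIntegral_congr_fun (measurableSet_Ioi.prod measurableSet_Ioo) fun p hp => ?_
  have hhom : F (p.1 * Real.cos p.2, p.1 * Real.sin p.2) =
      p.1 ^ k * F (Real.cos p.2, Real.sin p.2) := by
    rw [← hF _ _ hp.1, Prod.smul_mk, smul_eq_mul, smul_eq_mul]
  have hnorm : (p.1 * Real.cos p.2) ^ 2 + (p.1 * Real.sin p.2) ^ 2 = p.1 ^ 2 := by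
    rw [mul_pow, mul_pow, ← mul_add, Real.cos_sq_add_sin_sq, mul_one]
  simp only [polarCoord_symm_apply, smul_eq_mul, hhom, hnorm]
  ring

/-- The plane sector of all points that have a positive inner product with both `(1, 0)` and
`(cos θ, sin θ)`; it is the trace of the cone `{g | 0 < ⟪x, g⟫ ∧ 0 < ⟪y, g⟫}` on the plane of `x`
and `y` when `θ` is their angle. -/
def sector (θ : ℝ) : Set (ℝ × ℝ) := {p | 0 < p.1 ∧ 0 < Real.cos θ * p.1 + Real.sin θ * p.2}

theorem measurableSet_sector (θ : ℝ) : MeasurableSet (sector θ) :=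
  (measurableSet_lt measurable_const measurable_fst).inter
    (measurableSet_lt measurable_const
      ((measurable_fst.const_mul _).add (measurable_snd.const_mul _)))

theorem smul_mem_sector_iff {θ r : ℝ} (hr : 0 < r) (p : ℝ × ℝ) :
    r • p ∈ sector θ ↔ p ∈ sector θ := by
  have hlinear : Real.cos θ * (r * p.1) + Real.sin θ * (r * p.2) =
      r * (Real.cos θ * p.1 + Real.sin θ * p.2) := by ring
  simp only [sector, Set.mem_ofPred_eq, Prod.smul_fst, Prod.smul_snd, smul_eq_mul, hlinear,
    mul_pos_iff_of_pos_left hr]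

theorem cos_pos_iff_of_abs_lt {φ : ℝ} (hφ : |φ| < 3 * (Real.pi / 2)) :
    0 < Real.cos φ ↔ |φ| < Real.pi / 2 := by
  rw [← Real.cos_abs]
  refine ⟨fun hcos => ?_, fun h => Real.cos_pos_of_mem_Ioo
    ⟨by linarith [abs_nonneg φ, Real.pi_pos], h⟩⟩
  by_contra! h
  exact hcos.not_ge (Real.cos_nonpos_of_pi_div_two_le_of_le h (by linarith))

theorem cos_sin_mem_sector_iff {θ φ : ℝ} (h0 : 0 ≤ θ) (hπ : θ ≤ Real.pi)
    (hφ : φ ∈ Set.Ioo (-Real.pi) Real.pi) :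
    (Real.cos φ, Real.sin φ) ∈ sector θ ↔ φ ∈ Set.Ioo (θ - Real.pi / 2) (Real.pi / 2) := by
  have hsub : Real.cos θ * Real.cos φ + Real.sin θ * Real.sin φ = Real.cos (φ - θ) := by
    rw [Real.cos_sub]; ring
  have hcos : 0 < Real.cos φ ↔ |φ| < Real.pi / 2 :=
    cos_pos_iff_of_abs_lt
      (abs_lt.2 ⟨by linarith [hφ.1, Real.pi_pos], by linarith [hφ.2, Real.pi_pos]⟩)
  simp only [sector, Set.mem_ofPred_eq, hsub, Set.mem_Ioo, hcos]
  refine ⟨fun ⟨h1, h2⟩ => ?_, fun ⟨_, h2⟩ => ?_⟩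
  · have habs : |φ - θ| < Real.pi / 2 := (cos_pos_iff_of_abs_lt (abs_lt.2
      ⟨by linarith [(abs_lt.1 h1).1], by linarith [(abs_lt.1 h1).2]⟩)).1 h2
    exact ⟨by linarith [(abs_lt.1 habs).1], (abs_lt.1 h1).2⟩
  · exact ⟨abs_lt.2 ⟨by linarith, h2⟩, Real.cos_pos_of_mem_Ioo ⟨by linarith, by linarith⟩⟩

theorem setIntegral_sector_homogeneous {k : ℕ} {F : ℝ × ℝ → ℝ}
    (hF : ∀ (r : ℝ) p, 0 < r → F (r • p) = r ^ k * F p) {θ : ℝ} (h0 : 0 ≤ θ)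
    (hπ : θ ≤ Real.pi) :
    ∫ p in sector θ, F p ∂(gaussianReal 0 1).prod (gaussianReal 0 1) =
      2 ^ ((k : ℝ) / 2) * Real.Gamma ((k : ℝ) / 2 + 1) / (2 * Real.pi) *
        ∫ φ in (θ - Real.pi / 2)..(Real.pi / 2), F (Real.cos φ, Real.sin φ) := by
  have hhom (r : ℝ) (p : ℝ × ℝ) (hr : 0 < r) :
      (sector θ).indicator F (r • p) = r ^ k * (sector θ).indicator F p := by
    by_cases hp : p ∈ sector θ
    · rw [Set.indicator_of_mem hp, Set.indicator_of_mem ((smul_mem_sector_iff hr p).2 hp),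
        hF r p hr]
    · rw [Set.indicator_of_notMem hp,
        Set.indicator_of_notMem (mt (smul_mem_sector_iff hr p).1 hp), mul_zero]
  have harc : Set.Ioo (θ - Real.pi / 2) (Real.pi / 2) =
      Set.Ioo (-Real.pi) Real.pi ∩ Set.Ioo (θ - Real.pi / 2) (Real.pi / 2) :=
    (Set.inter_eq_right.2 (Set.Ioo_subset_Ioo (by linarith [Real.pi_pos])
      (by linarith [Real.pi_pos]))).symm
  rw [← integral_indicator (measurableSet_sector θ), integral_gaussianReal_prod_homogeneous hhom,
    intervalIntegral.integral_of_le (by linarith), integral_Ioc_eq_integral_Ioo, harc,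
    ← setIntegral_indicator measurableSet_Ioo]
  congr 1
  refine setIntegral_congr_fun measurableSet_Ioo fun φ hφ => ?_
  have harc_mem := cos_sin_mem_sector_iff h0 hπ hφ
  by_cases hmem : φ ∈ Set.Ioo (θ - Real.pi / 2) (Real.pi / 2)
  · simp only [Set.indicator_of_mem hmem, Set.indicator_of_mem (harc_mem.2 hmem)]
  · simp only [Set.indicator_of_notMem hmem, Set.indicator_of_notMem (mt harc_mem.1 hmem)]

theorem measureReal_sector {θ : ℝ} (h0 : 0 ≤ θ) (hπ : θ ≤ Real.pi) :
    ((gaussianReal 0 1).prod (gaussianReal 0 1)).real (sector θ) =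
      (Real.pi - θ) / (2 * Real.pi) := by
  have h := setIntegral_sector_homogeneous (k := 0) (F := fun _ => 1) (by simp) h0 hπ
  simp only [setIntegral_const, smul_eq_mul, mul_one, intervalIntegral.integral_const,
    Nat.cast_zero, zero_div, Real.rpow_zero, zero_add, Real.Gamma_one] at h
  rw [h]
  ring

theorem integral_sq_cos_add_sin (θ a b : ℝ) :
    ∫ φ in (θ - Real.pi / 2)..(Real.pi / 2), (a * Real.cos φ + b * Real.sin φ) ^ 2 =
      ((Real.pi - θ) * (a ^ 2 + b ^ 2) +
        Real.sin θ * ((a ^ 2 - b ^ 2) * Real.cos θ + 2 * a * b * Real.sin θ)) / 2 := by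
  have hderiv (φ : ℝ) : HasDerivAt (fun φ => (a ^ 2 + b ^ 2) / 2 * φ +
      (a ^ 2 - b ^ 2) / 2 * (Real.sin φ * Real.cos φ) + a * b * Real.sin φ ^ 2)
      ((a * Real.cos φ + b * Real.sin φ) ^ 2) φ := by
    refine ((((hasDerivAt_id φ).const_mul ((a ^ 2 + b ^ 2) / 2)).add
      (((Real.hasDerivAt_sin φ).mul (Real.hasDerivAt_cos φ)).const_mul
        ((a ^ 2 - b ^ 2) / 2))).add
      (((Real.hasDerivAt_sin φ).pow 2).const_mul (a * b))).congr_deriv ?_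
    push_cast
    linear_combination (-(a ^ 2 + b ^ 2) / 2) * Real.sin_sq_add_cos_sq φ
  rw [intervalIntegral.integral_eq_sub_of_hasDerivAt (fun φ _ => hderiv φ)
    (Continuous.intervalIntegrable (by fun_prop) _ _), Real.sin_sub_pi_div_two,
    Real.cos_sub_pi_div_two, Real.sin_pi_div_two, Real.cos_pi_div_two]
  linear_combination -(a * b) * Real.sin_sq_add_cos_sq θ

theorem setIntegral_sector_sq {θ : ℝ} (h0 : 0 ≤ θ) (hπ : θ ≤ Real.pi) (a b : ℝ) :
    ∫ p in sector θ, (a * p.1 + b * p.2) ^ 2 ∂(gaussianReal 0 1).prod (gaussianReal 0 1) =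
      (Real.pi - θ) / (2 * Real.pi) * (a ^ 2 + b ^ 2) + Real.sin θ / (2 * Real.pi) *
        ((a ^ 2 - b ^ 2) * Real.cos θ + 2 * a * b * Real.sin θ) := by
  have hradial : (2 : ℝ) ^ (((2 : ℕ) : ℝ) / 2) * Real.Gamma (((2 : ℕ) : ℝ) / 2 + 1) = 2 := by
    norm_num [Real.Gamma_two]
  rw [setIntegral_sector_homogeneous (k := 2)
    (fun r p _ => by simp only [Prod.smul_fst, Prod.smul_snd, smul_eq_mul]; ring) h0 hπ, hradial,
    integral_sq_cos_add_sin]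
  ring

end PlanarSectors

section GaussianCone

theorem setIntegral_prod_univ_add_sq {α : Type*} [MeasurableSpace α] {μ : Measure α}
    [IsFiniteMeasure μ] {ν : Measure ℝ} [IsProbabilityMeasure ν] {L : α → ℝ} (hL : MemLp L 2 μ)
    (hν : MemLp (fun z => z) 2 ν) (hmean : ∫ z, z ∂ν = 0) (S : Set α) :
    ∫ p in S ×ˢ Set.univ, (L p.1 + p.2) ^ 2 ∂μ.prod ν =
      ∫ p in S, L p ^ 2 ∂μ + (∫ z, z ^ 2 ∂ν) * μ.real S := by
  have hinner (c : ℝ) : ∫ z, (c + z) ^ 2 ∂ν = c ^ 2 + ∫ z, z ^ 2 ∂ν := by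
    have hexpand (z : ℝ) : (c + z) ^ 2 = c ^ 2 + 2 * c * z + z ^ 2 := by ring
    have hid : Integrable (fun z => z) ν := hν.integrable one_le_two
    have hlinear : Integrable (fun z => c ^ 2 + 2 * c * z) ν :=
      (integrable_const _).add (hid.const_mul _)
    simp only [hexpand]
    rw [integral_add hlinear hν.integrable_sq,
      integral_add (integrable_const _) (hid.const_mul _), integral_const_mul, hmean,
      integral_const, probReal_univ, one_smul, mul_zero, add_zero]
  have hsum : Integrable (fun p : α × ℝ => (L p.1 + p.2) ^ 2) (μ.prod ν) :=
    ((hL.comp_fst ν).add (hν.comp_snd μ)).integrable_sq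
  rw [setIntegral_prod _ hsum.integrableOn]
  simp only [Measure.restrict_univ, hinner]
  rw [integral_add hL.integrable_sq.integrableOn (integrable_const _), setIntegral_const,
    smul_eq_mul, mul_comm]

section InnerProductSpace

variable {E : Type*} [NormedAddCommGroup E] [InnerProductSpace ℝ E]

theorem exists_unit_mem_orthogonal_sub_smul_mem {K : Submodule ℝ E} [K.HasOrthogonalProjection]
    (hK : K ≠ ⊤) (v : E) : ∃ e ∈ Kᗮ, ‖e‖ = 1 ∧ ∃ c : ℝ, 0 ≤ c ∧ v - c • e ∈ K := by
  obtain ⟨y, hy, z, hz, rfl⟩ := K.exists_add_mem_mem_orthogonal v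
  by_cases hz0 : z = 0
  · obtain ⟨w, hw, hw0⟩ :=
      Submodule.exists_mem_ne_zero_of_ne_bot (mt Submodule.orthogonal_eq_bot_iff.1 hK)
    refine ⟨‖w‖⁻¹ • w, Submodule.smul_mem _ _ hw, norm_smul_inv_norm (𝕜 := ℝ) hw0, 0, le_rfl, ?_⟩
    rwa [hz0, add_zero, zero_smul, sub_zero]
  · refine ⟨‖z‖⁻¹ • z, Submodule.smul_mem _ _ hz, norm_smul_inv_norm (𝕜 := ℝ) hz0, ‖z‖,
      norm_nonneg _, ?_⟩
    rwa [smul_inv_smul₀ (norm_ne_zero_iff.2 hz0), add_sub_cancel_right]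

theorem exists_eq_cos_angle_smul_add_sin_angle_smul (hE : 1 < Module.finrank ℝ E) {x y : E}
    (hx : ‖x‖ = 1) (hy : ‖y‖ = 1) :
    ∃ e : E, ‖e‖ = 1 ∧ inner ℝ x e = 0 ∧
      y = Real.cos (InnerProductGeometry.angle x y) • x +
        Real.sin (InnerProductGeometry.angle x y) • e := by
  have hproper : Submodule.span ℝ {x} ≠ ⊤ := fun h => by
    have := finrank_span_le_card (R := ℝ) ({x} : Set E)
    rw [h, finrank_top, Set.toFinset_singleton, Finset.card_singleton] at this
    omega
  obtain ⟨e, he, he1, b, hb, hyb⟩ := exists_unit_mem_orthogonal_sub_smul_mem hproper y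
  obtain ⟨a, ha⟩ := Submodule.mem_span_singleton.1 hyb
  have hxe : inner ℝ x e = 0 := he x (Submodule.mem_span_singleton_self x)
  have hyab : y = a • x + b • e := by rw [ha, sub_add_cancel]
  have hcos : Real.cos (InnerProductGeometry.angle x y) = a := by
    rw [InnerProductGeometry.cos_angle, hx, hy, hyab, inner_add_right, real_inner_smul_right,
      real_inner_smul_right, hxe, real_inner_self_eq_norm_sq, hx]
    ring
  have hsin : Real.sin (InnerProductGeometry.angle x y) = b := by
    have hnorm : ‖y‖ ^ 2 = a ^ 2 + b ^ 2 := by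
      rw [hyab, norm_add_sq_real, real_inner_smul_left, real_inner_smul_right, hxe, norm_smul,
        norm_smul, hx, he1, mul_one, mul_one, Real.norm_eq_abs, Real.norm_eq_abs, sq_abs, sq_abs]
      ring
    have hpyth := Real.sin_sq_add_cos_sq (InnerProductGeometry.angle x y)
    rw [hcos] at hpyth
    rw [hy] at hnorm
    exact (pow_left_inj₀ (InnerProductGeometry.sin_angle_nonneg x y) hb two_ne_zero).1
      (by linarith)
  exact ⟨e, he1, hxe, by rw [hcos, hsin, ← hyab]⟩

theorem exists_eq_smul_add_smul_add_of_orthonormal {e₀ e₁ : E} (h₀ : ‖e₀‖ = 1) (h₁ : ‖e₁‖ = 1)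
    (h₀₁ : inner ℝ e₀ e₁ = 0) (u : E) :
    ∃ (a b : ℝ) (q : E), inner ℝ e₀ q = 0 ∧ inner ℝ e₁ q = 0 ∧ u = a • e₀ + b • e₁ + q := by
  refine ⟨inner ℝ e₀ u, inner ℝ e₁ u, u - (inner ℝ e₀ u • e₀ + inner ℝ e₁ u • e₁), ?_, ?_,
    (add_sub_cancel _ _).symm⟩ <;>
  simp only [inner_sub_right, inner_add_right, real_inner_smul_right, real_inner_self_eq_norm_sq,
    h₀, h₁, h₀₁, real_inner_comm e₀ e₁] <;>
  ring

variable [FiniteDimensional ℝ E] [MeasurableSpace E] [BorelSpace E]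

theorem hasLaw_prodMk_inner_stdGaussian {e₀ e₁ q : E} (h₀ : ‖e₀‖ = 1) (h₁ : ‖e₁‖ = 1)
    (h₀₁ : inner ℝ e₀ e₁ = 0) (h₀q : inner ℝ e₀ q = 0) (h₁q : inner ℝ e₁ q = 0) :
    HasLaw (fun g => ((inner ℝ e₀ g, inner ℝ e₁ g), inner ℝ q g))
      (((gaussianReal 0 1).prod (gaussianReal 0 1)).prod (gaussianReal 0 (‖q‖₊ ^ 2)))
      (stdGaussian E) := by
  have hpair : Pairwise fun i j => inner ℝ (![e₀, e₁, q] i) (![e₀, e₁, q] j) = 0 := by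
    intro i j hij
    fin_cases i <;> fin_cases j <;>
      simp_all [real_inner_comm e₀ e₁, real_inner_comm e₀ q, real_inner_comm e₁ q]
  have hindep := iIndepFun_inner_stdGaussian hpair
  have hfst := (hindep.indepFun (i := 0) (j := 1) (by decide)).hasLaw_prod
    (hasLaw_inner_stdGaussian_of_norm_eq_one h₀) (hasLaw_inner_stdGaussian_of_norm_eq_one h₁)
  exact (hindep.indepFun_prodMk (fun i => by fun_prop) 0 1 2 (by decide) (by decide)).hasLaw_prod
    hfst (hasLaw_inner_stdGaussian q)

theorem setIntegral_sector_inner_sq {e₀ e₁ q : E} (h₀ : ‖e₀‖ = 1) (h₁ : ‖e₁‖ = 1)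
    (h₀₁ : inner ℝ e₀ e₁ = 0) (h₀q : inner ℝ e₀ q = 0) (h₁q : inner ℝ e₁ q = 0) {θ : ℝ}
    (hθ : 0 ≤ θ) (hπ : θ ≤ Real.pi) (a b : ℝ) :
    ∫ g in {g | (inner ℝ e₀ g, inner ℝ e₁ g) ∈ sector θ},
        inner ℝ (a • e₀ + b • e₁ + q) g ^ 2 ∂stdGaussian E =
      (Real.pi - θ) / (2 * Real.pi) * ‖a • e₀ + b • e₁ + q‖ ^ 2 + Real.sin θ / (2 * Real.pi) *
        ((a ^ 2 - b ^ 2) * Real.cos θ + 2 * a * b * Real.sin θ) := by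
  have hlaw := hasLaw_prodMk_inner_stdGaussian h₀ h₁ h₀₁ h₀q h₁q
  have hid (v : NNReal) : MemLp (fun z => z) 2 (gaussianReal 0 v) := memLp_id_gaussianReal 2
  have hL : MemLp (fun p : ℝ × ℝ => a * p.1 + b * p.2) 2
      ((gaussianReal 0 1).prod (gaussianReal 0 1)) :=
    (((hid 1).comp_fst _).const_mul a).add (((hid 1).comp_snd _).const_mul b)
  have hvar : ∫ z, z ^ 2 ∂gaussianReal 0 (‖q‖₊ ^ 2) = ‖q‖ ^ 2 := by
    rw [← variance_of_integral_eq_zero (by fun_prop) integral_id_gaussianReal,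
      variance_fun_id_gaussianReal, NNReal.coe_pow, coe_nnnorm]
  have hnorm : ‖a • e₀ + b • e₁ + q‖ ^ 2 = a ^ 2 + b ^ 2 + ‖q‖ ^ 2 := by
    rw [norm_add_sq_real, norm_add_sq_real, inner_add_left]
    simp only [real_inner_smul_left, real_inner_smul_right, norm_smul, h₀, h₁, h₀₁, h₀q, h₁q,
      Real.norm_eq_abs, mul_one, sq_abs]
    ring
  calc _ = ∫ p in sector θ ×ˢ Set.univ, (a * p.1.1 + b * p.1.2 + p.2) ^ 2
          ∂((gaussianReal 0 1).prod (gaussianReal 0 1)).prod (gaussianReal 0 (‖q‖₊ ^ 2)) := by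
        rw [← hlaw.map_eq, setIntegral_map ((measurableSet_sector θ).prod .univ) (by fun_prop)
          (by fun_prop)]
        simp only [inner_add_left, real_inner_smul_left, Set.prod_univ]
        rfl
    _ = _ := by
        rw [setIntegral_prod_univ_add_sq hL (hid _) integral_id_gaussianReal,
          setIntegral_sector_sq hθ hπ, measureReal_sector hθ hπ, hvar, hnorm]
        ring

end InnerProductSpace

theorem unitVec_of_norm_eq_one {n : ℕ} {x : EuclideanSpace ℝ (Fin n)} (hx : ‖x‖ = 1) :
    unitVec x = x := by
  rw [unitVec, hx, inv_one, one_smul]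

theorem sin_mul_inner_toEuclideanCLM_swapMatrix {n : ℕ} {x y e q : EuclideanSpace ℝ (Fin n)}
    (hx : ‖x‖ = 1) (hy : ‖y‖ = 1) (he : ‖e‖ = 1) (hxe : inner ℝ x e = 0) {θ : ℝ}
    (hye : y = Real.cos θ • x + Real.sin θ • e) (hxq : inner ℝ x q = 0) (heq : inner ℝ e q = 0)
    (a b : ℝ) :
    Real.sin θ * inner ℝ (a • x + b • e + q)
        (Matrix.toEuclideanCLM (n := Fin n) (𝕜 := ℝ) (swapMatrix x y) (a • x + b • e + q)) =
      Real.sin θ * ((a ^ 2 - b ^ 2) * Real.cos θ + 2 * a * b * Real.sin θ) := by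
  set M := Matrix.toEuclideanCLM (n := Fin n) (𝕜 := ℝ) (swapMatrix x y)
  have hx0 : x ≠ 0 := norm_ne_zero_iff.1 (hx.trans_ne one_ne_zero)
  have hy0 : y ≠ 0 := norm_ne_zero_iff.1 (hy.trans_ne one_ne_zero)
  have hMx : M x = y := by
    have h := swapMatrix_mulVec_left hx0 hy0
    rw [unitVec_of_norm_eq_one hx, unitVec_of_norm_eq_one hy] at h
    exact WithLp.ofLp_injective 2 h
  have hMy : M y = x := by
    have h := swapMatrix_mulVec_right hx0 hy0
    rw [unitVec_of_norm_eq_one hx, unitVec_of_norm_eq_one hy] at h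
    exact WithLp.ofLp_injective 2 h
  have hyq : inner ℝ y q = 0 := by
    rw [hye, inner_add_left, real_inner_smul_left, real_inner_smul_left, hxq, heq, mul_zero,
      mul_zero, add_zero]
  have hMq : M q = 0 := WithLp.ofLp_injective 2 (swapMatrix_mulVec_orthogonal hxq hyq)
  have hMe : Real.sin θ • M e = x - Real.cos θ • y := by
    rw [← map_smul, eq_sub_of_add_eq' hye.symm, map_sub, map_smul, hMx, hMy]
  have hMu : Real.sin θ • M (a • x + b • e + q) =
      (a * Real.sin θ - b * Real.cos θ) • y + b • x := by
    rw [map_add, map_add, map_smul, map_smul, hMx, hMq, add_zero, smul_add,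
      smul_comm (Real.sin θ) b, hMe]
    module
  rw [← real_inner_smul_right, hMu, hye]
  simp only [inner_add_left, inner_add_right, real_inner_smul_left, real_inner_smul_right,
    real_inner_self_eq_norm_sq, hx, he, hxe, real_inner_comm x e, real_inner_comm x q,
    real_inner_comm e q, hxq, heq]
  linear_combination (- a * b) * Real.sin_sq_add_cos_sq θ

theorem inner_toEuclideanCLM_QMatrix {n : ℕ} (x y u : EuclideanSpace ℝ (Fin n)) :
    inner ℝ u (Matrix.toEuclideanCLM (n := Fin n) (𝕜 := ℝ) (QMatrix x y) u) =
      (Real.pi - InnerProductGeometry.angle x y) / (2 * Real.pi) * ‖u‖ ^ 2 +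
        Real.sin (InnerProductGeometry.angle x y) / (2 * Real.pi) *
          inner ℝ u (Matrix.toEuclideanCLM (n := Fin n) (𝕜 := ℝ) (swapMatrix x y) u) := by
  simp only [QMatrix, map_add, map_smul, map_one, add_apply, smul_apply, one_apply_eq_self,
    inner_add_right, real_inner_smul_right, real_inner_self_eq_norm_sq]

theorem setIntegral_cone_inner_sq {n : ℕ} (hn : 2 ≤ n) {x y : EuclideanSpace ℝ (Fin n)}
    (hx : ‖x‖ = 1) (hy : ‖y‖ = 1) (u : EuclideanSpace ℝ (Fin n)) :
    ∫ g in {g | 0 < inner ℝ x g ∧ 0 < inner ℝ y g}, inner ℝ u g ^ 2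
        ∂stdGaussian (EuclideanSpace ℝ (Fin n)) =
      inner ℝ u (Matrix.toEuclideanCLM (n := Fin n) (𝕜 := ℝ) (QMatrix x y) u) := by
  rw [inner_toEuclideanCLM_QMatrix]
  obtain ⟨e, he, hxe, hye⟩ := exists_eq_cos_angle_smul_add_sin_angle_smul
    (by rwa [finrank_euclideanSpace_fin]) hx hy
  obtain ⟨a, b, q, hxq, heq, rfl⟩ := exists_eq_smul_add_smul_add_of_orthonormal hx he hxe u
  have hcone : {g | 0 < inner ℝ x g ∧ 0 < inner ℝ y g} =
      {g | (inner ℝ x g, inner ℝ e g) ∈ sector (InnerProductGeometry.angle x y)} := by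
    ext g
    rw [Set.mem_ofPred_eq, hye, inner_add_left, real_inner_smul_left, real_inner_smul_left, ← hye]
    rfl
  rw [hcone, setIntegral_sector_inner_sq hx he hxe hxq heq
    (InnerProductGeometry.angle_nonneg x y) (InnerProductGeometry.angle_le_pi x y),
    div_mul_eq_mul_div (Real.sin _), div_mul_eq_mul_div (Real.sin _),
    sin_mul_inner_toEuclideanCLM_swapMatrix hx hy he hxe hye hxq heq]

end GaussianCone

section Bernstein

theorem exp_le_one_add_add_sq_mul_exp_abs (t : ℝ) :
    Real.exp t ≤ 1 + t + t ^ 2 * Real.exp |t| := by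
  have h := Complex.norm_exp_sub_sum_le_norm_mul_exp t 2
  simp only [Finset.sum_range_succ, Finset.sum_range_zero, pow_zero, Nat.factorial_zero,
    Nat.cast_one, div_one, zero_add, pow_one, Nat.factorial_one] at h
  rw [← Complex.ofReal_exp, ← Complex.ofReal_one, ← Complex.ofReal_add, ← Complex.ofReal_sub,
    Complex.norm_real, Complex.norm_real, Real.norm_eq_abs, Real.norm_eq_abs, sq_abs] at h
  linarith [(abs_le.1 h).2]

variable {Ω : Type*} [MeasurableSpace Ω] {P : Measure Ω}

section ExponentialMoment

variable {D : Ω → ℝ} {r t : ℝ}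

theorem exp_mul_le_one_add_add_sq_mul (ht : |t| ≤ r) (d : ℝ) :
    Real.exp (t * d) ≤ 1 + t * d + t ^ 2 * (d ^ 2 * Real.exp (r * |d|)) := by
  refine (exp_le_one_add_add_sq_mul_exp_abs _).trans ?_
  rw [mul_pow, mul_assoc, abs_mul]
  gcongr

theorem memLp_two_of_integrable_sq_mul_exp_abs (hD : AEStronglyMeasurable D P) (hr : 0 ≤ r)
    (hint : Integrable (fun ω => D ω ^ 2 * Real.exp (r * |D ω|)) P) : MemLp D 2 P :=
  (memLp_two_iff_integrable_sq hD).2 <| hint.mono' (hD.pow 2) <| .of_forall fun ω => by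
    rw [Real.norm_of_nonneg (sq_nonneg _)]
    exact le_mul_of_one_le_right (sq_nonneg _) (Real.one_le_exp (by positivity))

variable [IsProbabilityMeasure P]

theorem integrable_exp_mul_of_integrable_sq_mul_exp_abs (hD : AEStronglyMeasurable D P)
    (hint : Integrable (fun ω => D ω ^ 2 * Real.exp (r * |D ω|)) P) (ht : |t| ≤ r) :
    Integrable (fun ω => Real.exp (t * D ω)) P := by
  have hD1 := (memLp_two_of_integrable_sq_mul_exp_abs hD ((abs_nonneg t).trans ht) hint).integrable
    one_le_two
  refine (((integrable_const 1).add (hD1.const_mul t)).add (hint.const_mul (t ^ 2))).mono'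
    (Real.continuous_exp.comp_aestronglyMeasurable (hD.const_mul t)) (.of_forall fun ω => ?_)
  rw [Real.norm_of_nonneg (Real.exp_pos _).le]
  exact exp_mul_le_one_add_add_sq_mul ht _

theorem mgf_le_exp_mul_sq (hD : AEStronglyMeasurable D P) (hmean : ∫ ω, D ω ∂P = 0)
    (hint : Integrable (fun ω => D ω ^ 2 * Real.exp (r * |D ω|)) P) (ht : |t| ≤ r) {K : ℝ}
    (hK : ∫ ω, D ω ^ 2 * Real.exp (r * |D ω|) ∂P ≤ K) :
    mgf D P t ≤ Real.exp (K * t ^ 2) := by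
  have hD1 := (memLp_two_of_integrable_sq_mul_exp_abs hD ((abs_nonneg t).trans ht) hint).integrable
    one_le_two
  have hlinear : Integrable (fun ω => 1 + t * D ω) P := (integrable_const 1).add (hD1.const_mul t)
  calc mgf D P t ≤ ∫ ω, 1 + t * D ω + t ^ 2 * (D ω ^ 2 * Real.exp (r * |D ω|)) ∂P :=
        integral_mono (integrable_exp_mul_of_integrable_sq_mul_exp_abs hD hint ht)
          (hlinear.add (hint.const_mul _)) fun ω => exp_mul_le_one_add_add_sq_mul ht _
    _ = 1 + t ^ 2 * ∫ ω, D ω ^ 2 * Real.exp (r * |D ω|) ∂P := by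
        rw [integral_add hlinear (hint.const_mul _),
          integral_add (integrable_const _) (hD1.const_mul _), integral_const_mul,
          integral_const_mul, hmean, integral_const, probReal_univ, one_smul, mul_zero, add_zero]
    _ ≤ K * t ^ 2 + 1 := by
        rw [add_comm, mul_comm K]
        gcongr
    _ ≤ Real.exp (K * t ^ 2) := Real.add_one_le_exp _

end ExponentialMoment

variable {ι : Type*} [Fintype ι] {D : ι → Ω → ℝ} {r K ε : ℝ}

theorem measureReal_mul_card_le_sum_le (hD : ∀ i, AEStronglyMeasurable (D i) P)
    (hind : iIndepFun D P) (hmean : ∀ i, ∫ ω, D i ω ∂P = 0)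
    (hint : ∀ i, Integrable (fun ω => D i ω ^ 2 * Real.exp (r * |D i ω|)) P)
    (hK : ∀ i, ∫ ω, D i ω ^ 2 * Real.exp (r * |D i ω|) ∂P ≤ K) (hK0 : 0 < K) (hε : 0 ≤ ε)
    (hεr : ε ≤ 2 * K * r) :
    P.real {ω | ε * Fintype.card ι ≤ ∑ i, D i ω} ≤
      Real.exp (-(ε ^ 2 / (4 * K) * Fintype.card ι)) := by
  have := hind.isProbabilityMeasure
  have ht0 : 0 ≤ ε / (2 * K) := by positivity
  have htr : |ε / (2 * K)| ≤ r := by rwa [abs_of_nonneg ht0, div_le_iff₀' (by positivity)]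
  have hsum : (∑ i, D i) = fun ω => ∑ i, D i ω := funext fun ω => Finset.sum_apply _ _ _
  have hprod := hind.mgf_sum₀ (t := ε / (2 * K)) (fun i => (hD i).aemeasurable) Finset.univ
  rw [hsum] at hprod
  have hint_sum : Integrable (fun ω => Real.exp (ε / (2 * K) * ∑ i, D i ω)) P := by
    by_contra h
    rw [mgf_undef h] at hprod
    exact (Finset.prod_pos fun i _ => mgf_pos
      (integrable_exp_mul_of_integrable_sq_mul_exp_abs (hD i) (hint i) htr)).ne hprod
  have hmgf : mgf (fun ω => ∑ i, D i ω) P (ε / (2 * K)) ≤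
      Real.exp (K * (ε / (2 * K)) ^ 2) ^ Fintype.card ι := by
    rw [hprod, ← Finset.card_univ, ← Finset.prod_const]
    exact Finset.prod_le_prod (fun i _ => mgf_nonneg) fun i _ =>
      mgf_le_exp_mul_sq (hD i) (hmean i) (hint i) htr (hK i)
  calc P.real {ω | ε * Fintype.card ι ≤ ∑ i, D i ω}
      ≤ Real.exp (-(ε / (2 * K)) * (ε * Fintype.card ι)) *
          mgf (fun ω => ∑ i, D i ω) P (ε / (2 * K)) :=
        measure_ge_le_exp_mul_mgf _ ht0 hint_sum
    _ ≤ Real.exp (-(ε / (2 * K)) * (ε * Fintype.card ι)) *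
          Real.exp (K * (ε / (2 * K)) ^ 2) ^ Fintype.card ι := by gcongr
    _ = Real.exp (-(ε ^ 2 / (4 * K) * Fintype.card ι)) := by
        rw [← Real.exp_nat_mul, ← Real.exp_add]
        congr 1
        field_simp
        ring

theorem measureReal_mul_card_le_abs_sum_le (hD : ∀ i, AEStronglyMeasurable (D i) P)
    (hind : iIndepFun D P) (hmean : ∀ i, ∫ ω, D i ω ∂P = 0)
    (hint : ∀ i, Integrable (fun ω => D i ω ^ 2 * Real.exp (r * |D i ω|)) P)
    (hK : ∀ i, ∫ ω, D i ω ^ 2 * Real.exp (r * |D i ω|) ∂P ≤ K) (hK0 : 0 < K) (hε : 0 ≤ ε)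
    (hεr : ε ≤ 2 * K * r) :
    P.real {ω | ε * Fintype.card ι ≤ |∑ i, D i ω|} ≤
      2 * Real.exp (-(ε ^ 2 / (4 * K) * Fintype.card ι)) := by
  have := hind.isProbabilityMeasure
  have hupper := measureReal_mul_card_le_sum_le hD hind hmean hint hK hK0 hε hεr
  have hlower := measureReal_mul_card_le_sum_le (D := fun i ω => -D i ω) (fun i => (hD i).neg)
    (hind.comp (fun _ s => -s) fun _ => measurable_neg)
    (fun i => by rw [integral_neg, hmean i, neg_zero])
    (by simpa only [neg_sq, abs_neg] using hint) (by simpa only [neg_sq, abs_neg] using hK)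
    hK0 hε hεr
  have hunion : {ω | ε * Fintype.card ι ≤ |∑ i, D i ω|} ⊆
      {ω | ε * Fintype.card ι ≤ ∑ i, D i ω} ∪ {ω | ε * Fintype.card ι ≤ ∑ i, -D i ω} := by
    intro ω (hω : ε * Fintype.card ι ≤ |∑ i, D i ω|)
    exact (le_abs.1 hω).imp id fun h => h.trans_eq (Finset.sum_neg_distrib _).symm
  linarith [(measureReal_mono (μ := P) hunion).trans (measureReal_union_le _ _)]

end Bernstein

section GaussianMoments

theorem integral_exp_mul_sq_gaussianReal {s : ℝ} (hs : s < 1 / 2) :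
    ∫ t, Real.exp (s * t ^ 2) ∂(gaussianReal 0 1) = (Real.sqrt (1 - 2 * s))⁻¹ := by
  have hdensity : ∀ t : ℝ, gaussianPDFReal 0 1 t • Real.exp (s * t ^ 2) =
      (Real.sqrt (2 * Real.pi))⁻¹ * Real.exp (-(1 / 2 - s) * t ^ 2) := fun t => by
    simp only [gaussianPDFReal_def, NNReal.coe_one, mul_one, sub_zero, smul_eq_mul]
    rw [mul_assoc, ← Real.exp_add]
    ring_nf
  simp only [integral_gaussianReal_eq_integral_smul one_ne_zero, hdensity]
  rw [integral_const_mul, integral_gaussian, ← Real.sqrt_inv, ← Real.sqrt_inv,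
    ← Real.sqrt_mul (by positivity)]
  have : 1 / 2 - s ≠ 0 := by linarith
  have : 1 - 2 * s ≠ 0 := by linarith
  congr 1
  field_simp

theorem integrable_exp_mul_sq_gaussianReal {s : ℝ} (hs : s < 1 / 2) :
    Integrable (fun t => Real.exp (s * t ^ 2)) (gaussianReal 0 1) := by
  refine .of_integral_ne_zero ?_
  rw [integral_exp_mul_sq_gaussianReal hs]
  exact inv_ne_zero (Real.sqrt_ne_zero'.2 (by linarith))

theorem integral_exp_sq_div_four_gaussianReal :
    ∫ t, Real.exp (1 / 4 * t ^ 2) ∂(gaussianReal 0 1) = Real.sqrt 2 := by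
  rw [integral_exp_mul_sq_gaussianReal (by norm_num), ← Real.sqrt_inv]
  norm_num

theorem sq_le_two_div_sq_mul_exp {a x : ℝ} (ha : 0 < a) (hx : 0 ≤ x) :
    x ^ 2 ≤ 2 / a ^ 2 * Real.exp (a * x) := by
  have h := Real.quadratic_le_exp_of_nonneg (mul_nonneg ha.le hx)
  rw [div_mul_eq_mul_div, le_div_iff₀ (by positivity)]
  nlinarith [mul_nonneg ha.le hx]

theorem sq_add_one_sq_mul_exp_le (t : ℝ) :
    (t ^ 2 + 1) ^ 2 * Real.exp (1 / 8 * (t ^ 2 + 1)) ≤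
      128 * Real.sqrt 2 * Real.exp (1 / 4 * t ^ 2) := by
  have hsq : (t ^ 2 + 1) ^ 2 ≤ 128 * Real.exp (1 / 8 * (t ^ 2 + 1)) :=
    (sq_le_two_div_sq_mul_exp (by norm_num : (0 : ℝ) < 1 / 8) (by positivity)).trans_eq
      (by norm_num)
  have hexp : Real.exp (1 / 4) ≤ Real.sqrt 2 := by
    refine Real.le_sqrt_of_sq_le ((pow_le_pow_iff_left₀ (by positivity) (by norm_num)
      two_ne_zero).1 ?_)
    rw [← Real.exp_nat_mul, ← Real.exp_nat_mul]
    norm_num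
    linarith [Real.exp_one_lt_d9]
  calc (t ^ 2 + 1) ^ 2 * Real.exp (1 / 8 * (t ^ 2 + 1))
      ≤ 128 * Real.exp (1 / 8 * (t ^ 2 + 1)) * Real.exp (1 / 8 * (t ^ 2 + 1)) := by gcongr
    _ = 128 * Real.exp (1 / 4) * Real.exp (1 / 4 * t ^ 2) := by
        rw [mul_assoc, mul_assoc, ← Real.exp_add, ← Real.exp_add]
        ring_nf
    _ ≤ 128 * Real.sqrt 2 * Real.exp (1 / 4 * t ^ 2) := by gcongr

theorem integrable_sq_add_one_sq_mul_exp_gaussianReal :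
    Integrable (fun t : ℝ => (t ^ 2 + 1) ^ 2 * Real.exp (1 / 8 * (t ^ 2 + 1)))
      (gaussianReal 0 1) :=
  ((integrable_exp_mul_sq_gaussianReal (s := 1 / 4) (by norm_num)).const_mul _).mono'
    (by fun_prop) (.of_forall fun t => by
      rw [Real.norm_of_nonneg (by positivity)]; exact sq_add_one_sq_mul_exp_le t)

theorem integral_sq_add_one_sq_mul_exp_gaussianReal_le :
    ∫ t, (t ^ 2 + 1) ^ 2 * Real.exp (1 / 8 * (t ^ 2 + 1)) ∂(gaussianReal 0 1) ≤ 256 := by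
  refine (integral_mono integrable_sq_add_one_sq_mul_exp_gaussianReal
    ((integrable_exp_mul_sq_gaussianReal (by norm_num)).const_mul _)
    sq_add_one_sq_mul_exp_le).trans_eq ?_
  rw [integral_const_mul, integral_exp_sq_div_four_gaussianReal, mul_assoc,
    Real.mul_self_sqrt zero_le_two]
  norm_num

theorem integrable_pow_four_gaussianReal :
    Integrable (fun t : ℝ => t ^ 4) (gaussianReal 0 1) :=
  (memLp_id_gaussianReal 4).integrable_norm_pow (by norm_num) |>.congr
    (.of_forall fun t => by simp [Even.pow_abs (by decide : Even 4)])

theorem integral_pow_four_gaussianReal_le : ∫ t, t ^ 4 ∂(gaussianReal 0 1) ≤ 64 := by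
  have hle : ∀ t : ℝ, t ^ 4 ≤ 32 * Real.exp (1 / 4 * t ^ 2) := fun t => by
    have h := sq_le_two_div_sq_mul_exp (by norm_num : (0 : ℝ) < 1 / 4) (sq_nonneg t)
    rw [← pow_mul] at h
    exact h.trans_eq (by norm_num)
  calc ∫ t, t ^ 4 ∂(gaussianReal 0 1)
      ≤ ∫ t, 32 * Real.exp (1 / 4 * t ^ 2) ∂(gaussianReal 0 1) :=
        integral_mono integrable_pow_four_gaussianReal
          ((integrable_exp_mul_sq_gaussianReal (by norm_num)).const_mul _) hle
    _ = 32 * Real.sqrt 2 := by rw [integral_const_mul, integral_exp_sq_div_four_gaussianReal]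
    _ ≤ 64 := by linarith [Real.sqrt_le_self_iff.2 (.inr one_le_two)]

theorem integral_sq_gaussianReal : ∫ t, t ^ 2 ∂(gaussianReal 0 1) = 1 := by
  have h := variance_id_gaussianReal (μ := 0) (v := 1)
  rw [variance_eq_integral (by fun_prop)] at h
  simpa [integral_id_gaussianReal] using h

theorem measureReal_abs_le_gaussianReal {η : ℝ} (hη : 0 ≤ η) :
    (gaussianReal 0 1).real {t | |t| ≤ η} ≤ η := by
  have hdensity : ∀ t : ℝ, gaussianPDFReal 0 1 t ≤ 1 / 2 := fun t => by
    have hsqrt : (2 : ℝ) ≤ Real.sqrt (2 * Real.pi) :=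
      Real.le_sqrt_of_sq_le (by nlinarith [Real.two_le_pi])
    have hexp : Real.exp (-t ^ 2 / 2) ≤ 1 := Real.exp_le_one_iff.2 (by nlinarith [sq_nonneg t])
    simp only [gaussianPDFReal_def, NNReal.coe_one, mul_one, sub_zero]
    calc (Real.sqrt (2 * Real.pi))⁻¹ * Real.exp (-t ^ 2 / 2) ≤ 2⁻¹ * 1 := by gcongr
      _ = 1 / 2 := by norm_num
  have hset : {t : ℝ | |t| ≤ η} = Set.Icc (-η) η := Set.ext fun _ => abs_le (G := ℝ)
  rw [measureReal_def, gaussianReal_apply_eq_integral _ one_ne_zero, ENNReal.toReal_ofReal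
    (integral_nonneg fun t => gaussianPDFReal_nonneg _ _ _), hset]
  calc ∫ t in Set.Icc (-η) η, gaussianPDFReal 0 1 t
      ≤ ∫ _ in Set.Icc (-η) η, (1 / 2 : ℝ) :=
        setIntegral_mono (integrable_gaussianPDFReal 0 1).integrableOn
          (integrableOn_const (by simp)) hdensity
    _ = η := by
        rw [setIntegral_const, Real.volume_real_Icc_of_le (by linarith), smul_eq_mul]
        ring

variable {Ω : Type*} [MeasurableSpace Ω] {P : Measure Ω}

theorem integrable_comp_of_hasLaw {𝓧 : Type*} [MeasurableSpace 𝓧] {μ : Measure 𝓧} {Y : Ω → 𝓧}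
    {f : 𝓧 → ℝ} (hY : HasLaw Y μ P) (hf : Integrable f μ) : Integrable (fun ω => f (Y ω)) P :=
  Integrable.comp_aemeasurable (by rwa [hY.map_eq]) hY.aemeasurable

theorem integrable_sq_of_hasLaw_gaussianReal {Y : Ω → ℝ} (hY : HasLaw Y (gaussianReal 0 1) P) :
    Integrable (fun ω => Y ω ^ 2) P :=
  integrable_comp_of_hasLaw hY (memLp_id_gaussianReal 2).integrable_sq

theorem integral_sq_of_hasLaw_gaussianReal {Y : Ω → ℝ} (hY : HasLaw Y (gaussianReal 0 1) P) :
    ∫ ω, Y ω ^ 2 ∂P = 1 :=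
  (hY.integral_comp (by fun_prop)).trans integral_sq_gaussianReal

theorem setIntegral_sq_le_sqrt {f : Ω → ℝ} {s : Set Ω} [IsFiniteMeasure P]
    (hf : AEStronglyMeasurable f P) (hf4 : Integrable (fun ω => f ω ^ 4) P) :
    ∫ ω in s, f ω ^ 2 ∂P ≤ Real.sqrt (P.real s * ∫ ω, f ω ^ 4 ∂P) := by
  have hpow : ∀ ω, (f ω ^ 2) ^ 2 = f ω ^ 4 := fun ω => by ring
  have hmem : MemLp (fun ω => f ω ^ 2) 2 (P.restrict s) :=
    ((memLp_two_iff_integrable_sq (hf.pow 2)).2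
      (by simpa only [Pi.pow_apply, hpow] using hf4)).restrict s
  have hholder := integral_mul_le_Lp_mul_Lq_of_nonneg (μ := P.restrict s) (f := fun _ => (1 : ℝ))
    (g := fun ω => f ω ^ 2) .two_two (.of_forall fun _ => zero_le_one)
    (.of_forall fun ω => sq_nonneg (f ω)) (memLp_const 1) (by simpa using hmem)
  simp only [one_mul, Real.rpow_two, one_pow, hpow, setIntegral_const, smul_eq_mul, mul_one,
    ← Real.sqrt_eq_rpow] at hholder
  rw [← Real.sqrt_mul measureReal_nonneg] at hholder
  have hmono := setIntegral_le_integral (s := s) hf4 (.of_forall fun ω => by positivity)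
  exact hholder.trans (Real.sqrt_le_sqrt (by gcongr))

theorem setIntegral_sq_le_of_hasLaw_gaussianReal {X Y : Ω → ℝ}
    (hX : HasLaw X (gaussianReal 0 1) P) (hY : HasLaw Y (gaussianReal 0 1) P) {η : ℝ}
    (hη : 0 ≤ η) : ∫ ω in {ω | |X ω| ≤ η}, Y ω ^ 2 ∂P ≤ 8 * Real.sqrt η := by
  have := hX.isProbabilityMeasure
  have hslab : P.real {ω | |X ω| ≤ η} ≤ η :=
    (hX.measureReal_eq (measurableSet_le (by fun_prop) measurable_const)).trans_le
      (measureReal_abs_le_gaussianReal hη)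
  have hfour : ∫ ω, Y ω ^ 4 ∂P ≤ 64 :=
    (hY.integral_comp (by fun_prop)).trans_le integral_pow_four_gaussianReal_le
  calc ∫ ω in {ω | |X ω| ≤ η}, Y ω ^ 2 ∂P
      ≤ Real.sqrt (P.real {ω | |X ω| ≤ η} * ∫ ω, Y ω ^ 4 ∂P) :=
        setIntegral_sq_le_sqrt hY.aemeasurable.aestronglyMeasurable
          (integrable_comp_of_hasLaw hY integrable_pow_four_gaussianReal)
    _ ≤ Real.sqrt (η * 64) := by gcongr
    _ = 8 * Real.sqrt η := by
        rw [Real.sqrt_mul hη, mul_comm, show (64 : ℝ) = 8 ^ 2 by norm_num,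
          Real.sqrt_sq (by norm_num)]

theorem sq_mul_exp_abs_le_of_abs_le_sq_add_one {d y : ℝ} (h : |d| ≤ y ^ 2 + 1) :
    d ^ 2 * Real.exp (1 / 8 * |d|) ≤ (y ^ 2 + 1) ^ 2 * Real.exp (1 / 8 * (y ^ 2 + 1)) := by
  rw [← sq_abs d]
  gcongr

theorem integrable_sq_mul_exp_abs_of_abs_le {D Y : Ω → ℝ} (hD : AEStronglyMeasurable D P)
    (hY : HasLaw Y (gaussianReal 0 1) P) (hDY : ∀ ω, |D ω| ≤ Y ω ^ 2 + 1) :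
    Integrable (fun ω => D ω ^ 2 * Real.exp (1 / 8 * |D ω|)) P :=
  (integrable_comp_of_hasLaw hY integrable_sq_add_one_sq_mul_exp_gaussianReal).mono'
    ((hD.pow 2).mul (Real.continuous_exp.comp_aestronglyMeasurable (hD.norm.const_mul _)))
    (.of_forall fun ω => by
      rw [Real.norm_of_nonneg (by positivity)]
      exact sq_mul_exp_abs_le_of_abs_le_sq_add_one (hDY ω))

theorem integral_sq_mul_exp_abs_le_of_abs_le {D Y : Ω → ℝ} (hD : AEStronglyMeasurable D P)
    (hY : HasLaw Y (gaussianReal 0 1) P) (hDY : ∀ ω, |D ω| ≤ Y ω ^ 2 + 1) :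
    ∫ ω, D ω ^ 2 * Real.exp (1 / 8 * |D ω|) ∂P ≤ 256 :=
  calc ∫ ω, D ω ^ 2 * Real.exp (1 / 8 * |D ω|) ∂P
      ≤ ∫ ω, (Y ω ^ 2 + 1) ^ 2 * Real.exp (1 / 8 * (Y ω ^ 2 + 1)) ∂P :=
        integral_mono (integrable_sq_mul_exp_abs_of_abs_le hD hY hDY)
          (integrable_comp_of_hasLaw hY integrable_sq_add_one_sq_mul_exp_gaussianReal)
          fun ω => sq_mul_exp_abs_le_of_abs_le_sq_add_one (hDY ω)
    _ = ∫ t, (t ^ 2 + 1) ^ 2 * Real.exp (1 / 8 * (t ^ 2 + 1)) ∂(gaussianReal 0 1) :=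
        hY.integral_comp integrable_sq_add_one_sq_mul_exp_gaussianReal.aestronglyMeasurable
    _ ≤ 256 := integral_sq_add_one_sq_mul_exp_gaussianReal_le

theorem measureReal_mul_card_le_abs_sum_sub_le_of_le_sq {ι : Type*} [Fintype ι]
    {X Y : ι → Ω → ℝ} (hX : ∀ i, AEStronglyMeasurable (X i) P) (hind : iIndepFun X P)
    (hY : ∀ i, HasLaw (Y i) (gaussianReal 0 1) P) (hX0 : ∀ i ω, 0 ≤ X i ω)
    (hXY : ∀ i ω, X i ω ≤ Y i ω ^ 2) {m : ℝ} (hmean : ∀ i, ∫ ω, X i ω ∂P = m) {ε : ℝ}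
    (hε0 : 0 ≤ ε) (hε : ε ≤ 64) :
    P.real {ω | ε * Fintype.card ι ≤ |∑ i, X i ω - Fintype.card ι * m|} ≤
      2 * Real.exp (-(ε ^ 2 / 1024 * Fintype.card ι)) := by
  have := hind.isProbabilityMeasure
  have hint : ∀ i, Integrable (X i) P := fun i =>
    (integrable_sq_of_hasLaw_gaussianReal (hY i)).mono' (hX i) (.of_forall fun ω => by
      rw [Real.norm_of_nonneg (hX0 i ω)]; exact hXY i ω)
  have hm0 : ι → 0 ≤ m := fun i => hmean i ▸ integral_nonneg (hX0 i)
  have hm1 : ι → m ≤ 1 := fun i => by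
    rw [← hmean i, ← integral_sq_of_hasLaw_gaussianReal (hY i)]
    exact integral_mono (hint i) (integrable_sq_of_hasLaw_gaussianReal (hY i)) (hXY i)
  have habs : ∀ i ω, |X i ω - m| ≤ Y i ω ^ 2 + 1 := fun i ω => abs_le.2
    ⟨by linarith [hm1 i, hX0 i ω, sq_nonneg (Y i ω)], by linarith [hm0 i, hXY i ω]⟩
  have hmeas : ∀ i, AEStronglyMeasurable (fun ω => X i ω - m) P := fun i =>
    (hX i).sub aestronglyMeasurable_const
  have hcentered : ∀ i, ∫ ω, (X i ω - m) ∂P = 0 := fun i => by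
    rw [integral_sub (hint i) (integrable_const _), hmean i, integral_const, probReal_univ,
      one_smul, sub_self]
  have hbernstein := measureReal_mul_card_le_abs_sum_le hmeas
    (hind.comp (fun _ s => s - m) fun _ => by fun_prop) hcentered
    (fun i => integrable_sq_mul_exp_abs_of_abs_le (hmeas i) (hY i) (habs i))
    (fun i => integral_sq_mul_exp_abs_le_of_abs_le (hmeas i) (hY i) (habs i))
    (by norm_num) hε0 (by linarith)
  norm_num only [Finset.sum_sub_distrib, Finset.sum_const, Finset.card_univ, nsmul_eq_mul]
    at hbernstein
  exact hbernstein

end GaussianMoments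

section Nets

open scoped NNReal

variable {E : Type*} [NormedAddCommGroup E] [NormedSpace ℝ E] [FiniteDimensional ℝ E]

theorem card_le_pow_finrank_of_isSeparated {T : Finset E} {δ : ℝ≥0} (hδ : 0 < δ)
    (hT : ∀ t ∈ T, ‖t‖ ≤ 1) (hsep : Metric.IsSeparated δ (T : Set E)) :
    (T.card : ℝ) ≤ (1 + 2 / (δ : ℝ)) ^ Module.finrank ℝ E := by
  borelize E
  set μ : Measure E := Measure.addHaar
  set d := Module.finrank ℝ E
  have hball : ∀ (x : E) {r : ℝ}, 0 < r → μ.real (Metric.ball x r) =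
      r ^ d * μ.real (Metric.ball 0 1) := fun x r hr => by
    rw [measureReal_def, μ.addHaar_ball_of_pos x hr, ENNReal.toReal_mul,
      ENNReal.toReal_ofReal (by positivity), measureReal_def]
  have hunit : 0 < μ.real (Metric.ball (0 : E) 1) :=
    ENNReal.toReal_pos (Metric.measure_ball_pos _ _ one_pos).ne' measure_ball_lt_top.ne
  have hdisj : (T : Set E).PairwiseDisjoint fun t => Metric.ball t ((δ : ℝ) / 2) := by
    intro s hs t ht hst
    refine Metric.ball_disjoint_ball ?_
    rw [add_halves, ← coe_nndist, NNReal.coe_le_coe]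
    simpa only [edist_nndist, ENNReal.coe_le_coe] using (hsep hs ht hst).le
  have hsubset : ⋃ t ∈ T, Metric.ball t ((δ : ℝ) / 2) ⊆ Metric.ball 0 (1 + (δ : ℝ) / 2) :=
    Set.iUnion₂_subset fun t ht => Metric.ball_subset_ball' (by
      rw [dist_zero_right, add_comm]; gcongr; exact hT t ht)
  have hvolume : T.card * ((δ : ℝ) / 2) ^ d ≤ (1 + (δ : ℝ) / 2) ^ d := by
    refine le_of_mul_le_mul_right ?_ hunit
    calc T.card * ((δ : ℝ) / 2) ^ d * μ.real (Metric.ball 0 1)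
        = μ.real (⋃ t ∈ T, Metric.ball t ((δ : ℝ) / 2)) := by
          rw [measureReal_biUnion_finset hdisj fun t _ => Metric.isOpen_ball.measurableSet]
          simp only [hball _ (half_pos (NNReal.coe_pos.2 hδ)), Finset.sum_const, nsmul_eq_mul,
            mul_assoc]
      _ ≤ μ.real (Metric.ball 0 (1 + (δ : ℝ) / 2)) :=
          measureReal_mono hsubset measure_ball_lt_top.ne
      _ = (1 + (δ : ℝ) / 2) ^ d * μ.real (Metric.ball 0 1) := hball 0 (by positivity)
  rw [← le_div_iff₀ (by positivity), ← div_pow] at hvolume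
  refine hvolume.trans_eq ?_
  congr 1
  field_simp
  ring

theorem packingNumber_le_floor_pow_finrank {A : Set E} {δ : ℝ≥0} (hδ : 0 < δ)
    (hA : A ⊆ Metric.closedBall 0 1) :
    Metric.packingNumber δ A ≤ ⌊(1 + 2 / (δ : ℝ)) ^ Module.finrank ℝ E⌋₊ := by
  refine iSup₂_le fun C hC => iSup_le fun hsep => ?_
  by_contra! hlt
  obtain ⟨T, hTC, hTcard⟩ := Set.exists_subset_encard_eq (Order.add_one_le_of_lt hlt)
  lift T to Finset E using Set.finite_of_encard_eq_coe hTcard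
  have hle := card_le_pow_finrank_of_isSeparated hδ
    (fun t ht => mem_closedBall_zero_iff.1 (hA (hC (hTC ht)))) (hsep.mono hTC)
  rw [Set.encard_coe_eq_coe_finsetCard] at hTcard
  have hcard : T.card = ⌊(1 + 2 / (δ : ℝ)) ^ Module.finrank ℝ E⌋₊ + 1 := by
    exact_mod_cast hTcard
  exact absurd (Nat.le_floor hle) (by omega)

theorem exists_finset_isCover {A : Set E} {δ : ℝ≥0} (hδ : 0 < δ)
    (hA : A ⊆ Metric.closedBall 0 1) :
    ∃ T : Finset E, (T : Set E) ⊆ A ∧ (T.card : ℝ) ≤ (1 + 2 / (δ : ℝ)) ^ Module.finrank ℝ E ∧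
      Metric.IsCover δ A T := by
  have hle := (Metric.coveringNumber_le_packingNumber δ A).trans
    (packingNumber_le_floor_pow_finrank hδ hA)
  obtain ⟨T, hTA, hfin, hcover, hcard⟩ :=
    Metric.exists_set_encard_eq_coveringNumber (ne_top_of_le_ne_top (ENat.natCast_ne_top _) hle)
  lift T to Finset E using hfin
  rw [← hcard, Set.encard_coe_eq_coe_finsetCard, Nat.cast_le] at hle
  exact ⟨T, hTA, (Nat.le_floor_iff (by positivity)).1 hle, hcover⟩

theorem exists_finset_norm_eq_one_forall_exists_norm_sub_le {δ : ℝ} (hδ0 : 0 < δ) (hδ1 : δ ≤ 1) :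
    ∃ T : Finset E, (∀ t ∈ T, ‖t‖ = 1) ∧ (T.card : ℝ) ≤ (3 / δ) ^ Module.finrank ℝ E ∧
      ∀ x : E, ‖x‖ = 1 → ∃ t ∈ T, ‖x - t‖ ≤ δ := by
  lift δ to ℝ≥0 using hδ0.le
  obtain ⟨T, hTsphere, hcard, hcover⟩ := exists_finset_isCover (NNReal.coe_pos.1 hδ0)
    (Metric.sphere_subset_closedBall (x := (0 : E)) (ε := 1))
  refine ⟨T, fun t ht => mem_sphere_zero_iff_norm.1 (hTsphere ht), hcard.trans ?_,
    fun x hx => ?_⟩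
  · gcongr
    rw [← sub_nonneg]
    have : 1 ≤ 1 / (δ : ℝ) := (one_le_div hδ0).2 hδ1
    linear_combination this
  · obtain ⟨t, ht, hxt⟩ := hcover (mem_sphere_zero_iff_norm.2 hx)
    replace hxt : edist x t ≤ δ := hxt
    exact ⟨t, ht, by simpa only [edist_nndist, ENNReal.coe_le_coe, ← NNReal.coe_le_coe,
      coe_nndist, dist_eq_norm] using hxt⟩

end Nets

section ConeForms

variable {E : Type*} [NormedAddCommGroup E] [InnerProductSpace ℝ E]

/-- The intersection of the half-spaces `τ < ⟪x, g⟫` and `τ < ⟪y, g⟫` with the closed ball of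
radius `R`. The threshold `τ` is `0` in the weight distribution condition; the values `±η` sandwich
the cones of all pairs that are close to `(x, y)`. -/
def truncatedCone (R τ : ℝ) (x y : E) : Set E :=
  {g | τ < inner ℝ x g ∧ τ < inner ℝ y g ∧ ‖g‖ ≤ R}

/-- The contribution of the row `g` to the quadratic form of the truncated Gram matrix at `u`:
the square `⟪u, g⟫ ^ 2` if `g` lies in the truncated cone, and `0` otherwise. -/
noncomputable def coneForm (R τ : ℝ) (x y u : E) : E → ℝ :=
  (truncatedCone R τ x y).indicator fun g => inner ℝ u g ^ 2

theorem coneForm_nonneg (R τ : ℝ) (x y u g : E) : 0 ≤ coneForm R τ x y u g :=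
  Set.indicator_nonneg (fun _ _ => sq_nonneg _) g

theorem coneForm_le_inner_sq (R τ : ℝ) (x y u g : E) : coneForm R τ x y u g ≤ inner ℝ u g ^ 2 :=
  Set.indicator_le_self' (fun _ _ => sq_nonneg _) g

theorem coneForm_smul {r : ℝ} (hr : 0 < r) (R τ : ℝ) (x y u g : E) :
    coneForm (r * R) (r * τ) x y u (r • g) = r ^ 2 * coneForm R τ x y u g := by
  simp only [coneForm, truncatedCone, Set.indicator_apply, Set.mem_ofPred_eq,
    real_inner_smul_right, norm_smul, Real.norm_of_nonneg hr.le, mul_lt_mul_iff_right₀ hr,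
    mul_le_mul_iff_right₀ hr, mul_pow, mul_ite, mul_zero]

theorem abs_inner_sub_inner_le {a b g : E} {R δ : ℝ} (hab : ‖a - b‖ ≤ δ) (hg : ‖g‖ ≤ R) :
    |inner ℝ a g - inner ℝ b g| ≤ R * δ := by
  rw [← inner_sub_left, mul_comm]
  exact (abs_real_inner_le_norm _ _).trans
    (mul_le_mul hab hg (norm_nonneg _) ((norm_nonneg _).trans hab))

theorem abs_inner_sq_sub_inner_sq_le {a b g : E} {R δ : ℝ} (ha : ‖a‖ ≤ 1) (hb : ‖b‖ ≤ 1)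
    (hab : ‖a - b‖ ≤ δ) (hg : ‖g‖ ≤ R) :
    |inner ℝ a g ^ 2 - inner ℝ b g ^ 2| ≤ 2 * R ^ 2 * δ := by
  have hR : 0 ≤ R := (norm_nonneg g).trans hg
  have hle : ∀ {a : E}, ‖a‖ ≤ 1 → |inner ℝ a g| ≤ R := fun ha =>
    (abs_real_inner_le_norm _ _).trans
      ((mul_le_mul ha hg (norm_nonneg _) zero_le_one).trans_eq (one_mul R))
  rw [sq_sub_sq, abs_mul]
  calc |inner ℝ a g + inner ℝ b g| * |inner ℝ a g - inner ℝ b g| ≤ (R + R) * (R * δ) := by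
        gcongr
        · exact (abs_add_le _ _).trans (add_le_add (hle ha) (hle hb))
        · exact abs_inner_sub_inner_le hab hg
    _ = 2 * R ^ 2 * δ := by ring

theorem truncatedCone_add_mul_subset {x x' y y' : E} {R δ : ℝ} (hx : ‖x - x'‖ ≤ δ)
    (hy : ‖y - y'‖ ≤ δ) (τ : ℝ) :
    truncatedCone R (τ + R * δ) x y ⊆ truncatedCone R τ x' y' := fun g hg => by
  obtain ⟨hgx, hgy, hgR⟩ := hg
  have hx' := (abs_le.1 (abs_inner_sub_inner_le hx hgR)).2
  have hy' := (abs_le.1 (abs_inner_sub_inner_le hy hgR)).2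
  exact ⟨by linarith, by linarith, hgR⟩

theorem coneForm_add_mul_le {x x' y y' u u' : E} {R δ : ℝ} (hu : ‖u‖ ≤ 1) (hu' : ‖u'‖ ≤ 1)
    (hxx : ‖x - x'‖ ≤ δ) (hyy : ‖y - y'‖ ≤ δ) (huu : ‖u - u'‖ ≤ δ) (τ : ℝ) (g : E) :
    coneForm R (τ + R * δ) x y u g ≤ coneForm R τ x' y' u' g + 2 * R ^ 2 * δ := by
  by_cases hg : g ∈ truncatedCone R (τ + R * δ) x y
  · have hg' := truncatedCone_add_mul_subset hxx hyy τ hg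
    rw [coneForm, coneForm, Set.indicator_of_mem hg, Set.indicator_of_mem hg']
    linarith [(abs_le.1 (abs_inner_sq_sub_inner_sq_le hu hu' huu hg.2.2)).2]
  · rw [coneForm, Set.indicator_of_notMem hg]
    have hδ : 0 ≤ δ := (norm_nonneg _).trans hxx
    exact add_nonneg (coneForm_nonneg ..) (by positivity)

theorem sum_coneForm_add_mul_le {ι : Type*} [Fintype ι] {x x' y y' u u' : E} {R δ : ℝ}
    (hu : ‖u‖ ≤ 1) (hu' : ‖u'‖ ≤ 1) (hxx : ‖x - x'‖ ≤ δ) (hyy : ‖y - y'‖ ≤ δ)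
    (huu : ‖u - u'‖ ≤ δ) (τ : ℝ) (g : ι → E) :
    ∑ i, coneForm R (τ + R * δ) x y u (g i) ≤
      ∑ i, coneForm R τ x' y' u' (g i) + Fintype.card ι * (2 * R ^ 2 * δ) := by
  refine (Finset.sum_le_sum fun i _ => coneForm_add_mul_le hu hu' hxx hyy huu τ (g i)).trans_eq ?_
  rw [Finset.sum_add_distrib, Finset.sum_const, Finset.card_univ, nsmul_eq_mul]

theorem coneForm_neg_le_add_indicator (R η : ℝ) (x y u g : E) :
    coneForm R (-η) x y u g ≤ coneForm R η x y u g +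
      ({g | |inner ℝ x g| ≤ η}.indicator (fun g => inner ℝ u g ^ 2) g +
        {g | |inner ℝ y g| ≤ η}.indicator (fun g => inner ℝ u g ^ 2) g) := by
  simp only [coneForm, truncatedCone, Set.indicator_apply, Set.mem_ofPred_eq, abs_le]
  have hsq := sq_nonneg (inner ℝ u g)
  split_ifs <;> first | linarith | (exfalso; grind)

variable [MeasurableSpace E] [BorelSpace E]

theorem measurableSet_truncatedCone (R τ : ℝ) (x y : E) :
    MeasurableSet (truncatedCone R τ x y) :=
  (measurableSet_lt measurable_const (by fun_prop : Measurable fun g => inner ℝ x g)).inter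
    ((measurableSet_lt measurable_const (by fun_prop : Measurable fun g => inner ℝ y g)).inter
      (measurableSet_le measurable_norm measurable_const))

theorem measurable_coneForm (R τ : ℝ) (x y u : E) : Measurable (coneForm R τ x y u) :=
  Measurable.indicator (by fun_prop) (measurableSet_truncatedCone R τ x y)

variable [FiniteDimensional ℝ E]

theorem integrable_inner_sq_stdGaussian (u : E) :
    Integrable (fun g => inner ℝ u g ^ 2) (stdGaussian E) :=
  (IsGaussian.memLp_dual (stdGaussian E) (innerSL ℝ u) 2 (by simp)).integrable_sq

theorem integrable_coneForm (R τ : ℝ) (x y u : E) :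
    Integrable (coneForm R τ x y u) (stdGaussian E) :=
  (integrable_inner_sq_stdGaussian u).indicator (measurableSet_truncatedCone R τ x y)

theorem integral_coneForm_add_mul_le {x x' y y' u u' : E} {R δ : ℝ} (hu : ‖u‖ ≤ 1)
    (hu' : ‖u'‖ ≤ 1) (hxx : ‖x - x'‖ ≤ δ) (hyy : ‖y - y'‖ ≤ δ) (huu : ‖u - u'‖ ≤ δ) (τ : ℝ) :
    ∫ g, coneForm R (τ + R * δ) x y u g ∂(stdGaussian E) ≤
      ∫ g, coneForm R τ x' y' u' g ∂(stdGaussian E) + 2 * R ^ 2 * δ := by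
  have hmono := integral_mono (integrable_coneForm R (τ + R * δ) x y u)
    ((integrable_coneForm R τ x' y' u').add (integrable_const (2 * R ^ 2 * δ)))
    (coneForm_add_mul_le hu hu' hxx hyy huu τ)
  rwa [integral_add' (integrable_coneForm ..) (integrable_const _), integral_const, probReal_univ,
    one_smul] at hmono

theorem integral_coneForm_neg_le {x y u : E} (hx : ‖x‖ = 1) (hy : ‖y‖ = 1) (hu : ‖u‖ = 1)
    (R : ℝ) {η : ℝ} (hη : 0 ≤ η) :
    ∫ g, coneForm R (-η) x y u g ∂(stdGaussian E) ≤
      ∫ g, coneForm R η x y u g ∂(stdGaussian E) + 16 * Real.sqrt η := by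
  have hslab : ∀ x : E, MeasurableSet {g : E | |inner ℝ x g| ≤ η} := fun x =>
    measurableSet_le (by fun_prop) measurable_const
  have hint : ∀ x : E, Integrable ({g | |inner ℝ x g| ≤ η}.indicator fun g => inner ℝ u g ^ 2)
      (stdGaussian E) := fun x => (integrable_inner_sq_stdGaussian u).indicator (hslab x)
  have hslab_le : ∀ {x : E}, ‖x‖ = 1 →
      ∫ g in {g | |inner ℝ x g| ≤ η}, inner ℝ u g ^ 2 ∂(stdGaussian E) ≤ 8 * Real.sqrt η :=
    fun hx => setIntegral_sq_le_of_hasLaw_gaussianReal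
      (hasLaw_inner_stdGaussian_of_norm_eq_one hx) (hasLaw_inner_stdGaussian_of_norm_eq_one hu) hη
  have hmono := integral_mono (integrable_coneForm R (-η) x y u)
    ((integrable_coneForm R η x y u).add ((hint x).add (hint y)))
    (coneForm_neg_le_add_indicator R η x y u)
  rw [integral_add' (integrable_coneForm ..) ((hint x).add (hint y)),
    integral_add' (hint x) (hint y), integral_indicator (hslab x),
    integral_indicator (hslab y)] at hmono
  linarith [hslab_le hx, hslab_le hy]

theorem integral_coneForm_zero {n : ℕ} (hn : 2 ≤ n) {x y : EuclideanSpace ℝ (Fin n)}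
    (hx : ‖x‖ = 1) (hy : ‖y‖ = 1) (u : EuclideanSpace ℝ (Fin n)) :
    ∫ g, coneForm (3 * Real.sqrt n) 0 x y u g ∂(stdGaussian (EuclideanSpace ℝ (Fin n))) =
      truncAlpha n *
        inner ℝ u (Matrix.toEuclideanCLM (n := Fin n) (𝕜 := ℝ) (QMatrix x y) u) := by
  have : Nontrivial (Fin n) := Fin.nontrivial_iff_two_le.2 hn
  set cone : Set (EuclideanSpace ℝ (Fin n)) := {g | 0 < inner ℝ x g ∧ 0 < inner ℝ y g}
  have hcone : MeasurableSet cone :=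
    (measurableSet_lt measurable_const (by fun_prop : Measurable fun g => inner ℝ x g)).inter
      (measurableSet_lt measurable_const (by fun_prop : Measurable fun g => inner ℝ y g))
  have hball : MeasurableSet {g : EuclideanSpace ℝ (Fin n) | ‖g‖ ≤ 3 * Real.sqrt n} :=
    measurableSet_le measurable_norm measurable_const
  have hhom : ∀ (r : ℝ) (g : EuclideanSpace ℝ (Fin n)), 0 < r →
      cone.indicator (fun g => inner ℝ u g ^ 2) (r • g) =
        r ^ 2 * cone.indicator (fun g => inner ℝ u g ^ 2) g := fun r g hr => by
    simp only [cone, Set.indicator_apply, Set.mem_ofPred_eq, real_inner_smul_right,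
      mul_pos_iff_of_pos_left hr, mul_pow, mul_ite, mul_zero]
  have hform : coneForm (3 * Real.sqrt n) 0 x y u =
      {g | ‖g‖ ≤ 3 * Real.sqrt n}.indicator (cone.indicator fun g => inner ℝ u g ^ 2) := by
    rw [Set.indicator_indicator, coneForm]
    congr 1
    ext g
    exact ⟨fun h => ⟨h.2.2, h.1, h.2.1⟩, fun h => ⟨h.2.1, h.2.2, h.1⟩⟩
  have hradius : (3 * Real.sqrt n) ^ 2 / 2 = 9 * n / 2 := by
    rw [mul_pow, Real.sq_sqrt n.cast_nonneg]
    norm_num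
  rw [hform, integral_indicator hball, setIntegral_norm_le_stdGaussian_homogeneous hhom
    (by positivity), integral_indicator hcone, setIntegral_cone_inner_sq hn hx hy,
    finrank_euclideanSpace_fin, hradius, truncAlpha, Nat.cast_ofNat]

end ConeForms

section EmpiricalDeviation

variable {E : Type*} [NormedAddCommGroup E] [InnerProductSpace ℝ E] [FiniteDimensional ℝ E]
  [MeasurableSpace E] [BorelSpace E] {ι : Type*} [Fintype ι]

/-- The sum of the cone forms over a sample `g`, centred at its expectation for a sample of
standard Gaussian vectors. -/
noncomputable def coneDeviation (R τ : ℝ) (x y u : E) (g : ι → E) : ℝ :=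
  ∑ i, coneForm R τ x y u (g i) -
    Fintype.card ι * ∫ z, coneForm R τ x y u z ∂(stdGaussian E)

theorem abs_coneDeviation_le_of_norm_sub_le {x x' y y' u u' : E} {R δ ε : ℝ} (hR : 0 ≤ R)
    (hx' : ‖x'‖ = 1) (hy' : ‖y'‖ = 1) (hu : ‖u‖ = 1) (hu' : ‖u'‖ = 1) (hxx : ‖x - x'‖ ≤ δ)
    (hyy : ‖y - y'‖ ≤ δ) (huu : ‖u - u'‖ ≤ δ) {g : ι → E}
    (hpos : |coneDeviation R (R * δ) x' y' u' g| ≤ ε * Fintype.card ι)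
    (hneg : |coneDeviation R (-(R * δ)) x' y' u' g| ≤ ε * Fintype.card ι) :
    |coneDeviation R 0 x y u g| ≤
      (ε + 4 * R ^ 2 * δ + 16 * Real.sqrt (R * δ)) * Fintype.card ι := by
  have hxx' := norm_sub_rev x x' ▸ hxx
  have hyy' := norm_sub_rev y y' ▸ hyy
  have huu' := norm_sub_rev u u' ▸ huu
  have hη : 0 ≤ R * δ := mul_nonneg hR ((norm_nonneg _).trans hxx)
  have hsum_le := sum_coneForm_add_mul_le (R := R) hu.le hu'.le hxx hyy huu (-(R * δ)) g
  have hsum_ge := sum_coneForm_add_mul_le (R := R) hu'.le hu.le hxx' hyy' huu' 0 g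
  have hint_le := integral_coneForm_add_mul_le (R := R) hu.le hu'.le hxx hyy huu (-(R * δ))
  have hint_ge := integral_coneForm_add_mul_le (R := R) hu'.le hu.le hxx' hyy' huu' 0
  have hgap := integral_coneForm_neg_le hx' hy' hu' R hη
  rw [neg_add_cancel] at hsum_le hint_le
  rw [zero_add] at hsum_ge hint_ge
  have hcard : (0 : ℝ) ≤ Fintype.card ι := Nat.cast_nonneg _
  have hupper := mul_le_mul_of_nonneg_left (hgap.trans (add_le_add_left hint_ge _)) hcard
  have hlower := mul_le_mul_of_nonneg_left (hint_le.trans (add_le_add_left hgap _)) hcard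
  rw [coneDeviation] at hpos hneg ⊢
  rw [abs_le] at hpos hneg ⊢
  constructor <;> linarith [hpos.1, hneg.2]

theorem abs_coneDeviation_le_of_forall_mem_net {R δ ε : ℝ} (hR : 0 ≤ R) (hε : 0 ≤ ε)
    (hRδ : R * δ ≤ (ε / 64) ^ 2) (hR2δ : R ^ 2 * δ ≤ ε / 16) {T : Set E} (hT1 : ∀ t ∈ T, ‖t‖ = 1)
    (hT : ∀ x : E, ‖x‖ = 1 → ∃ t ∈ T, ‖x - t‖ ≤ δ) {g : ι → E}
    (hdev : ∀ x ∈ T, ∀ y ∈ T, ∀ u ∈ T, ∀ τ ∈ ({R * δ, -(R * δ)} : Finset ℝ),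
      |coneDeviation R τ x y u g| ≤ ε / 2 * Fintype.card ι)
    {x y u : E} (hx : ‖x‖ = 1) (hy : ‖y‖ = 1) (hu : ‖u‖ = 1) :
    |coneDeviation R 0 x y u g| ≤ ε * Fintype.card ι := by
  obtain ⟨x', hx', hxx⟩ := hT x hx
  obtain ⟨y', hy', hyy⟩ := hT y hy
  obtain ⟨u', hu', huu⟩ := hT u hu
  refine (abs_coneDeviation_le_of_norm_sub_le hR (hT1 x' hx') (hT1 y' hy') hu (hT1 u' hu') hxx hyy
    huu (hdev x' hx' y' hy' u' hu' _ (by simp)) (hdev x' hx' y' hy' u' hu' _ (by simp))).trans ?_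
  have hsqrt : Real.sqrt (R * δ) ≤ ε / 64 := Real.sqrt_le_left (by positivity) |>.2 hRδ
  gcongr
  linarith

variable {Ω : Type*} [MeasurableSpace Ω] {P : Measure Ω} {g : ι → Ω → E}

theorem measureReal_mul_card_le_abs_coneDeviation_le (hind : iIndepFun g P)
    (hg : ∀ i, HasLaw (g i) (stdGaussian E) P) (R τ : ℝ) (x y : E) {u : E} (hu : ‖u‖ = 1) {ε : ℝ}
    (hε0 : 0 ≤ ε) (hε : ε ≤ 64) :
    P.real {ω | ε * Fintype.card ι ≤ |coneDeviation R τ x y u fun i => g i ω|} ≤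
      2 * Real.exp (-(ε ^ 2 / 1024 * Fintype.card ι)) :=
  measureReal_mul_card_le_abs_sum_sub_le_of_le_sq
    (X := fun i ω => coneForm R τ x y u (g i ω)) (Y := fun i ω => inner ℝ u (g i ω))
    (fun i => ((measurable_coneForm ..).comp_aemeasurable (hg i).aemeasurable).aestronglyMeasurable)
    (hind.comp (fun _ => coneForm R τ x y u) fun _ => measurable_coneForm ..)
    (fun i => (hasLaw_inner_stdGaussian_of_norm_eq_one hu).fun_comp (hg i))
    (fun _ _ => coneForm_nonneg ..) (fun _ _ => coneForm_le_inner_sq ..)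
    (fun i => (hg i).integral_comp (measurable_coneForm ..).aestronglyMeasurable) hε0 hε

theorem measureReal_exists_mul_card_le_abs_coneDeviation_le (hind : iIndepFun g P)
    (hg : ∀ i, HasLaw (g i) (stdGaussian E) P) {T : Finset E} (hT : ∀ t ∈ T, ‖t‖ = 1)
    (S : Finset ℝ) (R : ℝ) {ε : ℝ} (hε0 : 0 ≤ ε) (hε : ε ≤ 64) :
    P.real {ω | ∃ x ∈ T, ∃ y ∈ T, ∃ u ∈ T, ∃ τ ∈ S,
        ε * Fintype.card ι ≤ |coneDeviation R τ x y u fun i => g i ω|} ≤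
      T.card ^ 3 * S.card * (2 * Real.exp (-(ε ^ 2 / 1024 * Fintype.card ι))) := by
  have hset : {ω | ∃ x ∈ T, ∃ y ∈ T, ∃ u ∈ T, ∃ τ ∈ S,
        ε * Fintype.card ι ≤ |coneDeviation R τ x y u fun i => g i ω|} =
      ⋃ p ∈ T ×ˢ T ×ˢ T ×ˢ S, {ω | ε * Fintype.card ι ≤
        |coneDeviation R p.2.2.2 p.1 p.2.1 p.2.2.1 fun i => g i ω|} := by
    ext ω
    simp only [Set.mem_ofPred_eq, Set.mem_iUnion, Finset.mem_product, Prod.exists, exists_prop,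
      and_assoc, exists_and_left]
  rw [hset]
  refine (measureReal_biUnion_finset_le _ _).trans ((Finset.sum_le_card_nsmul _ _ _ fun p hp =>
    measureReal_mul_card_le_abs_coneDeviation_le hind hg R _ _ _ (hT _ ?_) hε0 hε).trans_eq ?_)
  · simp only [Finset.mem_product] at hp
    exact hp.2.2.1
  · simp only [Finset.card_product, nsmul_eq_mul, Nat.cast_mul]
    ring

theorem measureReal_not_forall_abs_coneDeviation_le (hind : iIndepFun g P)
    (hg : ∀ i, HasLaw (g i) (stdGaussian E) P) {R δ ε : ℝ} (hR : 0 ≤ R) (hδ0 : 0 < δ)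
    (hδ1 : δ ≤ 1) (hε0 : 0 ≤ ε) (hε : ε ≤ 128) (hRδ : R * δ ≤ (ε / 64) ^ 2)
    (hR2δ : R ^ 2 * δ ≤ ε / 16) :
    P.real {ω | ¬ ∀ x y u : E, ‖x‖ = 1 → ‖y‖ = 1 → ‖u‖ = 1 →
        |coneDeviation R 0 x y u fun i => g i ω| ≤ ε * Fintype.card ι} ≤
      4 * (3 / δ) ^ (3 * Module.finrank ℝ E) * Real.exp (-(ε ^ 2 / 4096 * Fintype.card ι)) := by
  have := hind.isProbabilityMeasure
  obtain ⟨T, hT1, hTcard, hT⟩ :=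
    exists_finset_norm_eq_one_forall_exists_norm_sub_le (E := E) hδ0 hδ1
  set S : Finset ℝ := {R * δ, -(R * δ)} with hS
  have hScard : (S.card : ℝ) ≤ 2 := by exact_mod_cast Finset.card_le_two
  calc _ ≤ P.real {ω | ∃ x ∈ T, ∃ y ∈ T, ∃ u ∈ T, ∃ τ ∈ S,
        ε / 2 * Fintype.card ι ≤ |coneDeviation R τ x y u fun i => g i ω|} := by
        refine measureReal_mono fun ω hω => ?_
        by_contra hsmall
        simp only [Set.mem_ofPred_eq, not_exists, not_and, not_le] at hsmall
        exact hω fun x y u => abs_coneDeviation_le_of_forall_mem_net hR hε0 hRδ hR2δ hT1 hT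
          fun x hx y hy u hu τ hτ => (hsmall x hx y hy u hu τ hτ).le
    _ ≤ T.card ^ 3 * S.card * (2 * Real.exp (-((ε / 2) ^ 2 / 1024 * Fintype.card ι))) :=
        measureReal_exists_mul_card_le_abs_coneDeviation_le hind hg hT1 S R (by positivity)
          (by linarith)
    _ ≤ ((3 / δ) ^ Module.finrank ℝ E) ^ 3 * 2 *
        (2 * Real.exp (-((ε / 2) ^ 2 / 1024 * Fintype.card ι))) := by gcongr
    _ = _ := by
        rw [← pow_mul, mul_comm _ 3]
        ring_nf

end EmpiricalDeviation

section WeightDistribution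

theorem opNorm_le_of_isSymmetric_of_forall_abs_inner_le {E : Type*} [NormedAddCommGroup E]
    [InnerProductSpace ℝ E] {A : E →L[ℝ] E} (hA : A.IsSymmetric) {ε : ℝ} (hε : 0 ≤ ε)
    (h : ∀ u : E, ‖u‖ = 1 → |inner ℝ u (A u)| ≤ ε) : ‖A‖ ≤ ε := by
  rw [A.norm_eq_iSup_rayleighQuotient hA]
  refine ciSup_le fun x => ?_
  rcases eq_or_ne x 0 with rfl | hx
  · rwa [ContinuousLinearMap.rayleighQuotient_apply_zero, abs_zero]
  · have hnorm : ‖‖x‖⁻¹ • x‖ = 1 := norm_smul_inv_norm (𝕜 := ℝ) hx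
    have hquad := h _ hnorm
    rwa [← A.rayleigh_smul x (inv_ne_zero (norm_ne_zero_iff.2 hx)),
      ContinuousLinearMap.rayleighQuotient, hnorm, ContinuousLinearMap.reApplyInnerSelf_apply,
      RCLike.re_to_real, real_inner_comm, one_pow, div_one]

theorem isHermitian_vecMulVec_self {m : Type*} (v : m → ℝ) :
    (Matrix.vecMulVec v v).IsHermitian := by
  rw [Matrix.IsHermitian, Matrix.conjTranspose_eq_transpose_of_trivial, Matrix.transpose_vecMulVec]

theorem isHermitian_QMatrix {n : ℕ} (x y : EuclideanSpace ℝ (Fin n)) :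
    (QMatrix x y).IsHermitian := by
  have hproj : ∀ v : EuclideanSpace ℝ (Fin n), (lineProj v).IsHermitian := fun v =>
    (isHermitian_vecMulVec_self v.ofLp).smul (.all _)
  exact (Matrix.isHermitian_one.smul (.all _)).add (((hproj _).sub (hproj _)).smul (.all _))

variable {ℓ n : ℕ}

theorem isHermitian_activeGram (W : Matrix (Fin ℓ) (Fin n) ℝ) (x y : EuclideanSpace ℝ (Fin n)) :
    (activeGram W x y).IsHermitian :=
  isSelfAdjoint_sum (R := Matrix (Fin n) (Fin n) ℝ) _ fun i _ =>
    ((isHermitian_vecMulVec_self (W i)).smul (.all _)).smul (.all _)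

theorem activeGram_smul_smul (W : Matrix (Fin ℓ) (Fin n) ℝ) (x y : EuclideanSpace ℝ (Fin n))
    {r s : ℝ} (hr : 0 < r) (hs : 0 < s) : activeGram W (r • x) (s • y) = activeGram W x y := by
  simp only [activeGram, WithLp.ofLp_smul, dotProduct_smul, smul_eq_mul,
    mul_pos_iff_of_pos_left hr, mul_pos_iff_of_pos_left hs]

theorem unitVec_smul (x : EuclideanSpace ℝ (Fin n)) {r : ℝ} (hr : 0 < r) :
    unitVec (r • x) = unitVec x := by
  rw [unitVec, unitVec, norm_smul, Real.norm_of_nonneg hr.le, smul_smul, mul_inv_rev,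
    inv_mul_cancel_right₀ hr.ne']

theorem QMatrix_smul_smul (x y : EuclideanSpace ℝ (Fin n)) {r s : ℝ} (hr : 0 < r) (hs : 0 < s) :
    QMatrix (r • x) (s • y) = QMatrix x y := by
  rw [QMatrix, QMatrix, swapMatrix, swapMatrix, unitVec_smul x hr, unitVec_smul y hs,
    InnerProductGeometry.angle_smul_left_of_pos _ _ hr,
    InnerProductGeometry.angle_smul_right_of_pos _ _ hs]

theorem WDC_of_forall_norm_eq_one {W : Matrix (Fin ℓ) (Fin n) ℝ} {ε α : ℝ} (hε : 0 < ε)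
    (hα0 : 0 < α) (hα1 : α ≤ 1)
    (h : ∀ x y u : EuclideanSpace ℝ (Fin n), ‖x‖ = 1 → ‖y‖ = 1 → ‖u‖ = 1 →
      |inner ℝ u (Matrix.toEuclideanCLM (n := Fin n) (𝕜 := ℝ) (activeGram W x y) u) -
        α * inner ℝ u (Matrix.toEuclideanCLM (n := Fin n) (𝕜 := ℝ) (QMatrix x y) u)| ≤ ε) :
    WDC W ε α := by
  refine ⟨hε, hα0, hα1, fun x y hx hy => ?_⟩
  rw [← activeGram_smul_smul W x y (inv_pos.2 (norm_pos_iff.2 hx)) (inv_pos.2 (norm_pos_iff.2 hy)),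
    ← QMatrix_smul_smul x y (inv_pos.2 (norm_pos_iff.2 hx)) (inv_pos.2 (norm_pos_iff.2 hy))]
  refine opNorm_le_of_isSymmetric_of_forall_abs_inner_le (Matrix.isSymmetric_toEuclideanLin_iff.2
    ((isHermitian_activeGram W _ _).sub ((isHermitian_QMatrix _ _).smul (.all _)))) hε.le
    fun u hu => ?_
  simpa only [map_sub, map_smul, sub_apply, smul_apply, inner_sub_right, real_inner_smul_right,
    unitVec] using h _ _ u (norm_unitVec hx) (norm_unitVec hy) hu

theorem inner_toEuclideanCLM_activeGram (W : Matrix (Fin ℓ) (Fin n) ℝ)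
    (x y u : EuclideanSpace ℝ (Fin n)) :
    inner ℝ u (Matrix.toEuclideanCLM (n := Fin n) (𝕜 := ℝ) (activeGram W x y) u) =
      ∑ i, if 0 < W i ⬝ᵥ x.ofLp ∧ 0 < W i ⬝ᵥ y.ofLp then (W i ⬝ᵥ u.ofLp) ^ 2 else 0 := by
  simp only [activeGram, map_sum, map_smul, sum_apply, smul_apply, inner_sum,
    real_inner_smul_right, ite_and]
  refine Finset.sum_congr rfl fun i _ => ?_
  rw [Matrix.inner_toEuclideanCLM, Matrix.vecMulVec_mulVec, op_smul_eq_smul, dotProduct_smul,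
    dotProduct_comm u.ofLp, smul_eq_mul, ← sq]
  split_ifs <;> simp only [one_mul, zero_mul]

theorem ite_dotProduct_truncVec_eq_coneForm (R : ℝ) (w x y u : EuclideanSpace ℝ (Fin n)) :
    (if 0 < (truncVec R w).ofLp ⬝ᵥ x.ofLp ∧ 0 < (truncVec R w).ofLp ⬝ᵥ y.ofLp then
      ((truncVec R w).ofLp ⬝ᵥ u.ofLp) ^ 2 else 0) = coneForm R 0 x y u w := by
  have hdot : ∀ v z : EuclideanSpace ℝ (Fin n), v.ofLp ⬝ᵥ z.ofLp = inner ℝ z v := fun v z => rfl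
  simp only [hdot, coneForm, truncatedCone, truncVec, Set.indicator_apply, Set.mem_ofPred_eq]
  by_cases h : ‖w‖ ≤ R
  · simp only [h, if_true, and_true]
  · simp only [h, if_false, and_false, inner_zero_right, lt_irrefl]

theorem mul_inner_toEuclideanCLM_activeGram_truncMatrix (hℓ : ℓ ≠ 0)
    (w : Fin ℓ → EuclideanSpace ℝ (Fin n)) (x y u : EuclideanSpace ℝ (Fin n)) :
    ℓ * inner ℝ u (Matrix.toEuclideanCLM (n := Fin n) (𝕜 := ℝ) (activeGram (truncMatrix w) x y) u) =
      ∑ i, coneForm (3 * Real.sqrt n) 0 x y u (Real.sqrt ℓ • w i) := by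
  have hℓ0 : (0 : ℝ) < ℓ := by positivity
  have hsqrt : 0 < Real.sqrt ℓ := Real.sqrt_pos.2 hℓ0
  have hradius : 3 * Real.sqrt n = Real.sqrt ℓ * (3 * Real.sqrt ((n : ℝ) / ℓ)) := by
    rw [Real.sqrt_div' _ hℓ0.le]
    field_simp
  rw [inner_toEuclideanCLM_activeGram, Finset.mul_sum]
  refine Finset.sum_congr rfl fun i _ => ?_
  have hscale := coneForm_smul hsqrt (3 * Real.sqrt ((n : ℝ) / ℓ)) 0 x y u (w i)
  rw [mul_zero, ← hradius, Real.sq_sqrt hℓ0.le] at hscale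
  rw [hscale, ← ite_dotProduct_truncVec_eq_coneForm]
  rfl

theorem WDC_of_forall_abs_coneDeviation_le (hℓ : ℓ ≠ 0) (hn : 2 ≤ n) {ε : ℝ} (hε : 0 < ε)
    {w : Fin ℓ → EuclideanSpace ℝ (Fin n)}
    (h : ∀ x y u : EuclideanSpace ℝ (Fin n), ‖x‖ = 1 → ‖y‖ = 1 → ‖u‖ = 1 →
      |coneDeviation (3 * Real.sqrt n) 0 x y u fun i => Real.sqrt ℓ • w i| ≤ ε * ℓ) :
    WDC (truncMatrix w) ε (truncAlpha n) := by
  refine WDC_of_forall_norm_eq_one hε (truncAlpha_pos (by omega)) (truncAlpha_le_one n)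
    fun x y u hx hy hu => ?_
  have hℓ0 : (0 : ℝ) < ℓ := by positivity
  have hdev := h x y u hx hy hu
  rw [coneDeviation, ← mul_inner_toEuclideanCLM_activeGram_truncMatrix hℓ, Fintype.card_fin,
    integral_coneForm_zero hn hx hy, ← mul_sub, abs_mul, abs_of_pos hℓ0, mul_comm ε] at hdev
  exact le_of_mul_le_mul_left hdev hℓ0

end WeightDistribution

section GaussianRows

open scoped MatrixOrder Matrix.Norms.L2Operator

theorem multivariateGaussian_zero_smul_one {ι : Type*} [Fintype ι] [DecidableEq ι] {c : ℝ}
    (hc : 0 ≤ c) :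
    multivariateGaussian 0 (c • (1 : Matrix ι ι ℝ)) =
      (stdGaussian (EuclideanSpace ℝ ι)).map (Real.sqrt c • ·) := by
  have hsqrt : CFC.sqrt (c • (1 : Matrix ι ι ℝ)) = Real.sqrt c • 1 := by
    lift c to NNReal using hc
    rw [← Algebra.algebraMap_eq_smul_one, ← Algebra.algebraMap_eq_smul_one, ← Real.coe_sqrt]
    exact CFC.sqrt_algebraMap
  rw [multivariateGaussian, hsqrt]
  congr 1
  ext1 z
  rw [map_smul, map_one, smul_apply, one_apply_eq_self, zero_add]

theorem map_smul_multivariateGaussian_zero_smul_one {ι : Type*} [Fintype ι] [DecidableEq ι]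
    {r c : ℝ} (hr : 0 ≤ r) (hc : 0 ≤ c) (hrc : r ^ 2 * c = 1) :
    (multivariateGaussian 0 (c • (1 : Matrix ι ι ℝ))).map (r • ·) =
      stdGaussian (EuclideanSpace ℝ ι) := by
  have hone : ∀ z : EuclideanSpace ℝ ι, r • Real.sqrt c • z = z := fun z => by
    rw [smul_smul, ← Real.sqrt_sq hr, ← Real.sqrt_mul (sq_nonneg r), hrc, Real.sqrt_one, one_smul]
  rw [multivariateGaussian_zero_smul_one hc, Measure.map_map (by fun_prop) (by fun_prop)]
  simp only [Function.comp_def, hone, Measure.map_id']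

end GaussianRows

section Probability

variable {Ω : Type*} [MeasurableSpace Ω] {P : Measure Ω}

theorem exists_measurableSet_one_sub_le_measureReal [IsProbabilityMeasure P] {p : Ω → Prop} {q : ℝ}
    (h : P.real {ω | ¬ p ω} ≤ q) :
    ∃ E : Set Ω, MeasurableSet E ∧ 1 - q ≤ P.real E ∧ ∀ ω ∈ E, p ω := by
  refine ⟨(toMeasurable P {ω | ¬ p ω})ᶜ, (measurableSet_toMeasurable P _).compl, ?_, fun ω hω => ?_⟩
  · rw [probReal_compl_eq_one_sub (measurableSet_toMeasurable P _), measureReal_def,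
      measure_toMeasurable, ← measureReal_def]
    gcongr
  · by_contra hp
    exact hω (subset_toMeasurable P _ hp)

variable {n ℓ : ℕ}

theorem hasLaw_sqrt_smul {X : Ω → EuclideanSpace ℝ (Fin n)} (hℓ : ℓ ≠ 0)
    (hX : HasLaw X (multivariateGaussian 0 ((1 / (ℓ : ℝ)) • (1 : Matrix (Fin n) (Fin n) ℝ))) P) :
    HasLaw (fun ω => Real.sqrt ℓ • X ω) (stdGaussian (EuclideanSpace ℝ (Fin n))) P := by
  have hsmul : HasLaw (fun z : EuclideanSpace ℝ (Fin n) => Real.sqrt ℓ • z) (stdGaussian _)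
      (multivariateGaussian 0 ((1 / (ℓ : ℝ)) • (1 : Matrix (Fin n) (Fin n) ℝ))) :=
    ⟨by fun_prop, map_smul_multivariateGaussian_zero_smul_one (Real.sqrt_nonneg _)
      (by positivity) (by rw [Real.sq_sqrt ℓ.cast_nonneg]; field_simp)⟩
  exact hsmul.fun_comp hX

theorem measureReal_not_WDC_le {w : Fin ℓ → Ω → EuclideanSpace ℝ (Fin n)}
    (hind : iIndepFun w P)
    (hlaw : ∀ i, HasLaw (w i) (multivariateGaussian 0
      ((1 / (ℓ : ℝ)) • (1 : Matrix (Fin n) (Fin n) ℝ))) P)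
    (hℓ : ℓ ≠ 0) (hn : 2 ≤ n) {ε : ℝ} (hε0 : 0 < ε) (hε1 : ε ≤ 1) :
    P.real {ω | ¬ WDC (truncMatrix fun i => w i ω) ε (truncAlpha n)} ≤
      4 * (36864 * n / ε ^ 2) ^ (3 * n) * Real.exp (-(ε ^ 2 / 4096 * ℓ)) := by
  have := hind.isProbabilityMeasure
  have hn1 : (1 : ℝ) ≤ n := by exact_mod_cast one_le_two.trans hn
  have hn0 : (0 : ℝ) < n := one_pos.trans_le hn1
  have hsqrt : Real.sqrt n ≤ n := Real.sqrt_le_iff.2 ⟨hn0.le, by nlinarith⟩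
  have hε2 : ε ^ 2 ≤ ε := by nlinarith
  have hglaw := fun i => hasLaw_sqrt_smul hℓ (hlaw i)
  have hgind : iIndepFun (fun i ω => Real.sqrt ℓ • w i ω) P :=
    hind.comp (fun _ z => Real.sqrt ℓ • z) fun _ => measurable_const_smul _
  have hdev := measureReal_not_forall_abs_coneDeviation_le hgind hglaw
    (R := 3 * Real.sqrt n) (δ := ε ^ 2 / (12288 * n)) (ε := ε) (by positivity) (by positivity)
    (by rw [div_le_one (by positivity)]; nlinarith) hε0.le (by linarith)
    (by
      calc 3 * Real.sqrt n * (ε ^ 2 / (12288 * n)) ≤ 3 * n * (ε ^ 2 / (12288 * n)) := by gcongr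
        _ = (ε / 64) ^ 2 := by field_simp; norm_num)
    (by
      rw [mul_pow, Real.sq_sqrt hn0.le]
      calc 3 ^ 2 * (n : ℝ) * (ε ^ 2 / (12288 * n)) = 9 / 12288 * ε ^ 2 := by field_simp; norm_num
        _ ≤ ε / 16 := by linarith)
  rw [show 3 / (ε ^ 2 / (12288 * n)) = 36864 * n / ε ^ 2 by field_simp; norm_num,
    finrank_euclideanSpace_fin, Fintype.card_fin] at hdev
  refine le_trans (measureReal_mono ?_) hdev
  exact fun ω hω hgood => hω (WDC_of_forall_abs_coneDeviation_le hℓ hn hε0 hgood)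

end Probability

section Constants

variable {n ℓ : ℕ} {ε : ℝ}

theorem pow_mul_exp_neg_le_exp_neg (hn1 : 1 ≤ n) (hε : 0 < ε) (hn : 36864 * ε⁻¹ ^ 2 ≤ n)
    (hℓ : 36864 * ε⁻¹ ^ 2 * n * Real.log n ≤ ℓ) :
    (36864 * n / ε ^ 2) ^ (3 * n) * Real.exp (-(ε ^ 2 / 4096 * ℓ)) ≤
      Real.exp (-(3 * n * Real.log n)) := by
  have hn0 : (0 : ℝ) < n := by exact_mod_cast hn1
  have hnet : (36864 * n / ε ^ 2) ^ (3 * n) ≤ Real.exp (6 * n * Real.log n) := by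
    calc (36864 * n / ε ^ 2) ^ (3 * n) = (36864 * ε⁻¹ ^ 2 * n) ^ (3 * n) := by
          congr 1; field_simp
      _ ≤ ((n : ℝ) * n) ^ (3 * n) := by gcongr
      _ = (n : ℝ) ^ (6 * n) := by rw [← sq, ← pow_mul]; congr 1; ring
      _ = Real.exp (6 * n * Real.log n) := by
        rw [← Real.exp_log (pow_pos hn0 _), Real.log_pow]; push_cast; rfl
  have hrate : 9 * n * Real.log n ≤ ε ^ 2 / 4096 * ℓ := by
    calc 9 * n * Real.log n = ε ^ 2 / 4096 * (36864 * ε⁻¹ ^ 2 * n * Real.log n) := by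
          field_simp; ring
      _ ≤ ε ^ 2 / 4096 * ℓ := by gcongr
  calc (36864 * n / ε ^ 2) ^ (3 * n) * Real.exp (-(ε ^ 2 / 4096 * ℓ))
      ≤ Real.exp (6 * n * Real.log n) * Real.exp (-(9 * n * Real.log n)) := by gcongr
    _ = Real.exp (-(3 * n * Real.log n)) := by rw [← Real.exp_add]; ring_nf

theorem one_le_log_natCast (hn : 3 ≤ n) : 1 ≤ Real.log n := by
  have hn' : (3 : ℝ) ≤ n := by exact_mod_cast hn
  rw [Real.le_log_iff_exp_le (by linarith)]
  linarith [Real.exp_one_lt_d9]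

theorem one_le_mul_natCast_mul_exp_neg {a : ℝ} (hn : 1 ≤ n) (ha : a ≤ 1) :
    1 ≤ 8 * (n : ℝ) * Real.exp (-a) := by
  have hn1 : (1 : ℝ) ≤ n := by exact_mod_cast hn
  have hexp : (1 : ℝ) / 8 ≤ Real.exp (-a) := by
    linarith [Real.exp_neg_one_gt_d9, Real.exp_le_exp.2 (neg_le_neg ha)]
  nlinarith

end Constants

theorem measureReal_not_WDC_le_exp {Ω : Type*} [MeasurableSpace Ω] {P : Measure Ω}
    [IsProbabilityMeasure P] {n ℓ : ℕ} {w : Fin ℓ → Ω → EuclideanSpace ℝ (Fin n)}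
    (hind : iIndepFun w P)
    (hlaw : ∀ i, HasLaw (w i) (multivariateGaussian 0
      ((1 / (ℓ : ℝ)) • (1 : Matrix (Fin n) (Fin n) ℝ))) P)
    (hn : 1 ≤ n) {ε : ℝ} (hε0 : 0 < ε) (hε1 : ε ≤ 1)
    (hℓ : 36864 * ε⁻¹ ^ 2 * n * Real.log n < ℓ) :
    P.real {ω | ¬ WDC (truncMatrix fun i => w i ω) ε (truncAlpha n)} ≤
      8 * (n : ℝ) * Real.exp (-(36864 * ε⁻¹ ^ 2)⁻¹ * n) := by
  set γ : ℝ := (36864 * ε⁻¹ ^ 2)⁻¹ with hγ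
  have hn1 : (1 : ℝ) ≤ n := by exact_mod_cast hn
  rw [neg_mul]
  rcases le_or_gt (γ * n) 1 with hsmall | hlarge
  · exact measureReal_le_one.trans (one_le_mul_natCast_mul_exp_neg hn hsmall)
  have hε2 : 1 ≤ ε⁻¹ ^ 2 := one_le_pow₀ (one_le_inv_iff₀.2 ⟨hε0, hε1⟩)
  have hγ1 : γ ≤ 1 := inv_le_one_of_one_le₀ (by linarith)
  have hn' : 36864 * ε⁻¹ ^ 2 ≤ n := by
    rw [hγ, ← div_eq_inv_mul, one_lt_div (by positivity)] at hlarge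
    exact hlarge.le
  have hn3 : 3 ≤ n := by
    have : (3 : ℝ) ≤ n := by linarith
    exact_mod_cast this
  have hℓ0 : ℓ ≠ 0 := by
    rintro rfl
    have : 0 ≤ 36864 * ε⁻¹ ^ 2 * n * Real.log n := by positivity
    simp only [Nat.cast_zero] at hℓ
    linarith
  have hlog : γ * n ≤ 3 * n * Real.log n := by nlinarith [one_le_log_natCast hn3, hn1]
  calc P.real {ω | ¬ WDC (truncMatrix fun i => w i ω) ε (truncAlpha n)}
      ≤ 4 * ((36864 * n / ε ^ 2) ^ (3 * n) * Real.exp (-(ε ^ 2 / 4096 * ℓ))) := by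
        rw [← mul_assoc]
        exact measureReal_not_WDC_le hind hlaw hℓ0 (by omega) hε0 hε1
    _ ≤ 4 * Real.exp (-(3 * n * Real.log n)) := by
        gcongr
        exact pow_mul_exp_neg_le_exp_neg hn hε0 hn' hℓ.le
    _ ≤ 8 * n * Real.exp (-(γ * n)) := by gcongr; linarith

theorem mainTheorem6 :
    ∃ (C : ℝ) (k : ℕ), 0 < C ∧ 0 < k ∧
      ∀ ε : ℝ, 0 < ε → ε < 1 →
        ∃ c γ : ℝ, 0 < c ∧ c ≤ C * ε⁻¹ ^ k ∧ 0 < γ ∧ γ⁻¹ ≤ C * ε⁻¹ ^ k ∧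
          ∀ (n ℓ : ℕ), 1 ≤ n → c * (n : ℝ) * Real.log (n : ℝ) < (ℓ : ℝ) →
            ∀ (Ω : Type*) [MeasurableSpace Ω] (P : Measure Ω) [IsProbabilityMeasure P]
              (w : Fin ℓ → Ω → EuclideanSpace ℝ (Fin n)),
              iIndepFun w P →
              (∀ i, HasLaw (w i) (multivariateGaussian 0
                ((1 / (ℓ : ℝ)) • (1 : Matrix (Fin n) (Fin n) ℝ))) P) →
              ∃ E : Set Ω, MeasurableSet E ∧
                1 - 8 * (n : ℝ) * Real.exp (-γ * (n : ℝ)) ≤ P.real E ∧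
                ∀ ω ∈ E, WDC (truncMatrix fun i => w i ω) ε (truncAlpha n) := by
  refine ⟨36864, 2, by norm_num, two_pos, fun ε hε0 hε1 => ?_⟩
  refine ⟨36864 * ε⁻¹ ^ 2, (36864 * ε⁻¹ ^ 2)⁻¹, by positivity, le_rfl, by positivity,
    (inv_inv _).le, fun n ℓ hn hℓ Ω _ P _ w hind hlaw => ?_⟩
  exact exists_measurableSet_one_sub_le_measureReal
    (measureReal_not_WDC_le_exp hind hlaw hn hε0 hε1.le hℓ)
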